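/- Let $R$ be a ring (associative, with unit) and let $\mathcal C$ be an $R$-coring, with comultiplication $\Delta(c)=c_{(1)}\otimes c_{(2)}$ and counit $\varepsilon$. Assume that $\mathcal C$ satisfies the left and the right $\alpha$-condition, that is, for every right $R$-module $N$ the map $N\otimes_R\mathcal C\to \mathrm{Hom}({}^*\mathcal C,N)$, $n\otimes c\mapsto (f\mapsto nf(c))$, is injective, and for every left $R$-module $N$ the map $\mathcal C\otimes_R N\to \mathrm{Hom}(\mathcal C^*,N)$, $c\otimes n\mapsto (f\mapsto f(c)n)$, is injective; here ${}^*\mathcal C={}_R\mathrm{Hom}(\mathcal C,R)$ and $\mathcal C^*=\mathrm{Hom}_R(\mathcal C,R)$ are the left and the right dual of $\mathcal C$. Assume moreover that 1. $\mathcal C$ is an injective object of the category ${}^{\mathcal C}\mathcal M$ of left $\mathcal C$-comodules; 2. $R$ is left artinian, or every finitely generated submodule of the left $R$-module $\mathcal C$ is artinian, or (more generally) every finitely generated left subcomodule of $\mathcal C$ satisfies the descending chain condition on subcomodules. Let $\bigoplus_{i\in I}S_i$ be a decomposition of the left socle of $\mathcal C$ (the sum of all simple left subcomodules of $\mathcal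 C$) into simple left subcomodules, and for each $i\in I$ let $E(S_i)\subseteq\mathcal C$ be a left subcomodule that is an injective hull of $S_i$ in ${}^{\mathcal C}\mathcal M$. View ${}^*\mathcal C$ as a ring with the multiplication $(f\# g)(c)=g(c_{(1)}f(c_{(2)}))$ and unit $\varepsilon$. For a right ${}^*\mathcal C$-module $M$ let $\mathrm{Rat}^{\mathcal C}(M)$ be the largest ${}^*\mathcal C$-submodule of $M$ that has a right $\mathcal C$-comodule structure $m\mapsto m_{[0]}\otimes m_{[1]}$ with $m\cdot f=m_{[0]}f(m_{[1]})$ for all $f\in{}^*\mathcal C$. Then the functor $\mathrm{Rat}^{\mathcal C}$ is exact if and only if every $E(S_i)$ is a finitely generated left $\mathcal C$-comodule. -/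

import Mathlib

open MulOpposite TensorProduct

universe u

/-! ### Tensor products over a noncommutative ring

Right `R`-modules are `Rᵐᵒᵖ`-modules: `x · r` is `op r • x`. -/

/-- The subgroup of the tensor product over `ℤ` that is generated by the elements
`(x · r) ⊗ y - x ⊗ (r • y)`. -/
def balancedRel (R N M : Type*) [Ring R] [AddCommGroup N] [Module Rᵐᵒᵖ N]
    [AddCommGroup M] [Module R M] : AddSubgroup (N ⊗[ℤ] M) :=
  AddSubgroup.closure
    {t | ∃ (x : N) (r : R) (y : M), t = (op r • x) ⊗ₜ[ℤ] y - x ⊗ₜ[ℤ] (r • y)}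

/-- The tensor product `N ⊗_R M` of a right `R`-module `N` and a left `R`-module `M`. -/
def BTensor (R N M : Type*) [Ring R] [AddCommGroup N] [Module Rᵐᵒᵖ N]
    [AddCommGroup M] [Module R M] : Type _ :=
  (N ⊗[ℤ] M) ⧸ balancedRel R N M

namespace BTensor

section Basic

variable {R N M P : Type*} [Ring R] [AddCommGroup N] [Module Rᵐᵒᵖ N]
  [AddCommGroup M] [Module R M] [AddCommGroup P]

noncomputable instance : AddCommGroup (BTensor R N M) :=
  inferInstanceAs (AddCommGroup ((N ⊗[ℤ] M) ⧸ balancedRel R N M))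

variable (R) in
/-- The pure tensor `x ⊗ y`. -/
def tmul (x : N) (y : M) : BTensor R N M :=
  QuotientAddGroup.mk' (balancedRel R N M) (x ⊗ₜ[ℤ] y)

theorem tmul_add (x : N) (y y' : M) : tmul R x (y + y') = tmul R x y + tmul R x y' := by
  unfold tmul; rw [TensorProduct.tmul_add]; exact map_add _ _ _

theorem add_tmul (x x' : N) (y : M) : tmul R (x + x') y = tmul R x y + tmul R x' y := by
  unfold tmul; rw [TensorProduct.add_tmul]; exact map_add _ _ _

theorem smul_tmul (x : N) (r : R) (y : M) : tmul R (op r • x) y = tmul R x (r • y) := by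
  unfold tmul
  have : (op r • x) ⊗ₜ[ℤ] y - x ⊗ₜ[ℤ] (r • y) ∈ balancedRel R N M :=
    AddSubgroup.subset_closure ⟨x, r, y, rfl⟩
  exact QuotientAddGroup.eq_iff_sub_mem.2 this

theorem induction {p : BTensor R N M → Prop} (h0 : p 0) (ht : ∀ x y, p (tmul R x y))
    (ha : ∀ s t, p s → p t → p (s + t)) (t : BTensor R N M) : p t := by
  obtain ⟨z, rfl⟩ := QuotientAddGroup.mk'_surjective (balancedRel R N M) t
  induction z using TensorProduct.induction_on with
  | zero => rw [map_zero]; exact h0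
  | tmul x y => exact ht x y
  | add s t hs ht => rw [map_add]; exact ha _ _ hs ht

theorem hom_ext {f g : BTensor R N M →+ P} (h : ∀ x y, f (tmul R x y) = g (tmul R x y)) :
    f = g := by
  ext t
  induction t using BTensor.induction with
  | h0 => simp
  | ht x y => exact h x y
  | ha s t hs ht => rw [map_add, map_add, hs, ht]

/-- The universal property: an `R`-balanced biadditive map induces a map on `N ⊗_R M`. -/
noncomputable def lift (φ : N →+ M →+ P)
    (h : ∀ (x : N) (r : R) (y : M), φ (op r • x) y = φ x (r • y)) : BTensor R N M →+ P :=
  QuotientAddGroup.lift (balancedRel R N M)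
    (TensorProduct.liftAddHom φ (fun n x y => by simp))
    ((AddSubgroup.closure_le _).2 (by
      rintro _ ⟨x, r, y, rfl⟩
      rw [SetLike.mem_coe, AddMonoidHom.mem_ker, map_sub, TensorProduct.liftAddHom_tmul,
        TensorProduct.liftAddHom_tmul, h, sub_self]))

@[simp] theorem lift_tmul (φ : N →+ M →+ P) (h) (x : N) (y : M) :
    lift (R := R) φ h (tmul R x y) = φ x y := by
  rfl

end Basic

section Map

variable {R N N' M M' : Type*} [Ring R]
  [AddCommGroup N] [Module Rᵐᵒᵖ N] [AddCommGroup N'] [Module Rᵐᵒᵖ N']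
  [AddCommGroup M] [Module R M] [AddCommGroup M'] [Module R M']

/-- The map `f ⊗ g : N ⊗_R M → N' ⊗_R M'`. -/
noncomputable def map (f : N →ₗ[Rᵐᵒᵖ] N') (g : M →ₗ[R] M') : BTensor R N M →+ BTensor R N' M' :=
  lift
    (AddMonoidHom.mk'
      (fun x => AddMonoidHom.mk' (fun y => tmul R (f x) (g y)) (by simp [tmul_add]))
      (by intro x x'; ext y; simp [add_tmul]))
    (by intro x r y; simp [smul_tmul])

@[simp] theorem map_tmul (f : N →ₗ[Rᵐᵒᵖ] N') (g : M →ₗ[R] M') (x : N) (y : M) :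
    map f g (tmul R x y) = tmul R (f x) (g y) := by
  rfl

end Map

section LeftModule

variable {R N M : Type*} [Ring R] [AddCommGroup N] [Module Rᵐᵒᵖ N] [Module R N]
  [SMulCommClass R Rᵐᵒᵖ N] [AddCommGroup M] [Module R M]

/-- Left multiplication by `r` on a bimodule, as a map of right modules. -/
def lmulHom (r : R) : N →ₗ[Rᵐᵒᵖ] N where
  toFun x := r • x
  map_add' := smul_add r
  map_smul' s x := smul_comm r s x

/-- If `N` is an `R`-bimodule, then `N ⊗_R M` is a left `R`-module: `r (x ⊗ y) = (r x) ⊗ y`. -/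
noncomputable instance : Module R (BTensor R N M) where
  smul r t := map (lmulHom r) LinearMap.id t
  one_smul t := by
    change map (lmulHom 1) LinearMap.id t = t
    induction t using BTensor.induction with
    | h0 => simp
    | ht x y => simp [lmulHom]
    | ha s t hs ht => rw [map_add, hs, ht]
  mul_smul r r' t := by
    change map (lmulHom (r * r')) LinearMap.id t
      = map (lmulHom r) LinearMap.id (map (lmulHom r') LinearMap.id t)
    induction t using BTensor.induction with
    | h0 => simp
    | ht x y => simp [lmulHom, mul_smul]
    | ha s t hs ht => rw [map_add, map_add, map_add, hs, ht]
  smul_zero r := map_zero _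
  smul_add r := map_add _
  add_smul r r' t := by
    change map (lmulHom (r + r')) LinearMap.id t
      = map (lmulHom r) LinearMap.id t + map (lmulHom r') LinearMap.id t
    induction t using BTensor.induction with
    | h0 => simp
    | ht x y => simp [lmulHom, add_smul, add_tmul]
    | ha s t hs ht => rw [map_add, map_add, map_add, hs, ht]; abel
  zero_smul t := by
    change map (lmulHom 0) LinearMap.id t = 0
    induction t using BTensor.induction with
    | h0 => simp
    | ht x y =>
      have h := add_tmul (R := R) (0 : N) 0 y
      rw [add_zero] at h
      simpa [lmulHom] using h
    | ha s t hs ht => rw [map_add, hs, ht, add_zero]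

@[simp] theorem smul_tmul' (r : R) (x : N) (y : M) :
    r • tmul R x y = tmul R (r • x) y := by
  rfl

end LeftModule

section RightModule

variable {R N M : Type*} [Ring R] [AddCommGroup N] [Module Rᵐᵒᵖ N]
  [AddCommGroup M] [Module R M] [Module Rᵐᵒᵖ M] [SMulCommClass R Rᵐᵒᵖ M]

/-- Right multiplication by `s` on a bimodule, as a map of left modules. -/
def rmulHom (s : Rᵐᵒᵖ) : M →ₗ[R] M where
  toFun x := s • x
  map_add' := smul_add s
  map_smul' r x := (smul_comm r s x).symm

/-- If `M` is an `R`-bimodule, then `N ⊗_R M` is a right `R`-module: `(x ⊗ y) r = x ⊗ (y r)`. -/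
noncomputable instance : Module Rᵐᵒᵖ (BTensor R N M) where
  smul r t := map LinearMap.id (rmulHom r) t
  one_smul t := by
    change map LinearMap.id (rmulHom 1) t = t
    induction t using BTensor.induction with
    | h0 => simp
    | ht x y => simp [rmulHom]
    | ha s t hs ht => rw [map_add, hs, ht]
  mul_smul r r' t := by
    change map LinearMap.id (rmulHom (r * r')) t
      = map LinearMap.id (rmulHom r) (map LinearMap.id (rmulHom r') t)
    induction t using BTensor.induction with
    | h0 => simp
    | ht x y => simp [rmulHom, mul_smul]
    | ha s t hs ht => rw [map_add, map_add, map_add, hs, ht]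
  smul_zero r := map_zero _
  smul_add r := map_add _
  add_smul r r' t := by
    change map LinearMap.id (rmulHom (r + r')) t
      = map LinearMap.id (rmulHom r) t + map LinearMap.id (rmulHom r') t
    induction t using BTensor.induction with
    | h0 => simp
    | ht x y => simp [rmulHom, add_smul, tmul_add]
    | ha s t hs ht => rw [map_add, map_add, map_add, hs, ht]; abel
  zero_smul t := by
    change map LinearMap.id (rmulHom 0) t = 0
    induction t using BTensor.induction with
    | h0 => simp
    | ht x y =>
      have h := tmul_add (R := R) x (0 : M) 0
      rw [add_zero] at h
      simpa [rmulHom] using h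
    | ha s t hs ht => rw [map_add, hs, ht, add_zero]

@[simp] theorem op_smul_tmul (s : Rᵐᵒᵖ) (x : N) (y : M) :
    s • tmul R x y = tmul R x (s • y) := by
  rfl

end RightModule

section Assoc

variable {R N B M : Type*} [Ring R] [AddCommGroup N] [Module Rᵐᵒᵖ N]
  [AddCommGroup B] [Module R B] [Module Rᵐᵒᵖ B] [SMulCommClass R Rᵐᵒᵖ B]
  [AddCommGroup M] [Module R M]

/-- The map `y ↦ x ⊗ (b ⊗ y)`. -/
noncomputable def tmulTmul (x : N) (b : B) : M →+ BTensor R N (BTensor R B M) :=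
  AddMonoidHom.mk' (fun y => tmul R x (tmul R b y)) (fun y y' => by rw [tmul_add, tmul_add])

theorem tmulTmul_apply (x : N) (b : B) (y : M) :
    tmulTmul (R := R) x b y = tmul R x (tmul R b y) := by
  rfl

/-- The map `x ⊗ b ↦ (y ↦ x ⊗ (b ⊗ y))`. -/
noncomputable def assocAux : BTensor R N B →+ M →+ BTensor R N (BTensor R B M) :=
  lift
    (AddMonoidHom.mk'
      (fun x => AddMonoidHom.mk' (fun b => tmulTmul x b)
        (fun b b' => AddMonoidHom.ext fun y => by
          rw [AddMonoidHom.add_apply, tmulTmul_apply, tmulTmul_apply, tmulTmul_apply,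
            add_tmul, tmul_add]))
      (fun x x' => AddMonoidHom.ext fun b => AddMonoidHom.ext fun y =>
        add_tmul x x' (tmul R b y)))
    (fun x r b => AddMonoidHom.ext fun y => smul_tmul x r (tmul R b y))

theorem assocAux_tmul (x : N) (b : B) (y : M) :
    assocAux (tmul R x b) y = tmul R x (tmul R b y) := by
  rfl

/-- The canonical map `(N ⊗_R B) ⊗_R M → N ⊗_R (B ⊗_R M)`, `(x ⊗ b) ⊗ y ↦ x ⊗ (b ⊗ y)`. -/
noncomputable def assoc : BTensor R (BTensor R N B) M →+ BTensor R N (BTensor R B M) :=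
  lift assocAux
    (by
      intro t r y
      induction t using BTensor.induction with
      | h0 => rw [smul_zero, map_zero, AddMonoidHom.zero_apply, AddMonoidHom.zero_apply]
      | ht x b => rw [op_smul_tmul, assocAux_tmul, assocAux_tmul, smul_tmul]
      | ha s t hs ht => rw [smul_add, map_add, map_add, AddMonoidHom.add_apply,
          AddMonoidHom.add_apply, hs, ht])

@[simp] theorem assoc_tmul (x : N) (b : B) (y : M) :
    assoc (tmul R (tmul R x b) y) = tmul R x (tmul R b y) := by
  rfl

end Assoc

section Contract

variable {R N M C : Type*} [Ring R] [AddCommGroup N] [Module Rᵐᵒᵖ N]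
  [AddCommGroup M] [Module R M] [AddCommGroup C]

/-- `N ⊗_R C → N`, `x ⊗ c ↦ x · f(c)`, for a left linear form `f` on `C`. -/
noncomputable def contractRight [Module R C] (f : C →ₗ[R] R) : BTensor R N C →+ N :=
  lift
    (AddMonoidHom.mk' (fun x => AddMonoidHom.mk' (fun c => op (f c) • x) (by simp [add_smul]))
      (by intro x x'; ext c; simp))
    (by intro x r c; simp [mul_smul])

/-- `C ⊗_R M → M`, `c ⊗ y ↦ f(c) y`, for a right linear form `f` on `C`. -/
noncomputable def contractLeft [Module Rᵐᵒᵖ C] (f : C →ₗ[Rᵐᵒᵖ] R) : BTensor R C M →+ M :=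
  lift
    (AddMonoidHom.mk' (fun c => AddMonoidHom.mk' (fun y => f c • y) (by simp))
      (by intro c c'; ext y; simp [add_smul]))
    (by intro c r y; simp [mul_smul])

@[simp] theorem contractRight_tmul [Module R C] (f : C →ₗ[R] R) (x : N) (c : C) :
    contractRight f (tmul R x c) = op (f c) • x := by
  rfl

@[simp] theorem contractLeft_tmul [Module Rᵐᵒᵖ C] (f : C →ₗ[Rᵐᵒᵖ] R) (c : C) (y : M) :
    contractLeft f (tmul R c y) = f c • y := by
  rfl

end Contract

end BTensor

/-! ### Corings -/

/-- An `R`-coring: an `R`-bimodule `C` with a coassociative comultiplication `C → C ⊗_R C` and a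
counit `C → R`, both of them maps of `R`-bimodules. -/
class Coring (R C : Type*) [Ring R] [AddCommGroup C] [Module R C] [Module Rᵐᵒᵖ C]
    [SMulCommClass R Rᵐᵒᵖ C] where
  /-- The comultiplication, as a map of left modules. -/
  comul : C →ₗ[R] BTensor R C C
  comul_op_smul : ∀ (s : Rᵐᵒᵖ) (c : C), comul (s • c) = s • comul c
  /-- The counit, as a map of left modules. -/
  counit : C →ₗ[R] R
  counit_op_smul : ∀ (s : Rᵐᵒᵖ) (c : C), counit (s • c) = s • counit c
  coassoc : ∀ c : C,
    BTensor.assoc (BTensor.map (⟨⟨comul, map_add comul⟩, comul_op_smul⟩ : C →ₗ[Rᵐᵒᵖ] BTensor R C C)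
        LinearMap.id (comul c)) =
      BTensor.map LinearMap.id comul (comul c)
  counit_comul : ∀ c : C,
    BTensor.contractLeft (⟨⟨counit, map_add counit⟩, counit_op_smul⟩ : C →ₗ[Rᵐᵒᵖ] R) (comul c) = c
  comul_counit : ∀ c : C, BTensor.contractRight counit (comul c) = c

namespace Coring

variable (R C : Type*) [Ring R] [AddCommGroup C] [Module R C] [Module Rᵐᵒᵖ C]
  [SMulCommClass R Rᵐᵒᵖ C] [Coring R C]

/-- The comultiplication, as a map of right modules. -/
noncomputable def comulR : C →ₗ[Rᵐᵒᵖ] BTensor R C C :=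
  ⟨⟨comul (R := R), map_add comul⟩, comul_op_smul⟩

/-- The counit, as a map of right modules. -/
noncomputable def counitR : C →ₗ[Rᵐᵒᵖ] R :=
  ⟨⟨counit (R := R), map_add counit⟩, counit_op_smul⟩

end Coring

/-! ### The two `α`-conditions -/

/-- The left `α`-condition for a left `R`-module `C`: for every right `R`-module `N` the map
`N ⊗_R C → Hom({}^*C, N)`, `x ⊗ c ↦ (f ↦ x f(c))`, is injective. -/
def LeftAlpha (R C : Type u) [Ring R] [AddCommGroup C] [Module R C] : Prop :=
  ∀ (N : Type u) [AddCommGroup N] [Module Rᵐᵒᵖ N],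
    Function.Injective
      (fun (t : BTensor R N C) (f : C →ₗ[R] R) => BTensor.contractRight f t)

/-- The right `α`-condition for a right `R`-module `C`: for every left `R`-module `N` the map
`C ⊗_R N → Hom(C^*, N)`, `c ⊗ y ↦ (f ↦ f(c) y)`, is injective. -/
def RightAlpha (R C : Type u) [Ring R] [AddCommGroup C] [Module Rᵐᵒᵖ C] : Prop :=
  ∀ (N : Type u) [AddCommGroup N] [Module R N],
    Function.Injective
      (fun (t : BTensor R C N) (f : C →ₗ[Rᵐᵒᵖ] R) => BTensor.contractLeft f t)

/-! ### The left dual ring -/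

/-- The left dual `{}^*C` of a coring: the left `R`-linear maps `C → R`. -/
def LeftDual (R C : Type*) [Ring R] [AddCommGroup C] [Module R C] : Type _ := C →ₗ[R] R

namespace LeftDual

variable {R C : Type*} [Ring R] [AddCommGroup C] [Module R C]

instance : AddCommGroup (LeftDual R C) := inferInstanceAs (AddCommGroup (C →ₗ[R] R))

/-- An element of the left dual, as a linear map. -/
def toLin (f : LeftDual R C) : C →ₗ[R] R := f

theorem toLin_add (f g : LeftDual R C) : (f + g).toLin = f.toLin + g.toLin := by
  rfl

theorem toLin_zero : (0 : LeftDual R C).toLin = 0 := by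
  rfl

theorem ext {f g : LeftDual R C} (h : ∀ c, f.toLin c = g.toLin c) : f = g :=
  LinearMap.ext h

variable [Module Rᵐᵒᵖ C] [SMulCommClass R Rᵐᵒᵖ C]

theorem contractRight_smul (f : C →ₗ[R] R) (r : R) (t : BTensor R C C) :
    BTensor.contractRight f (r • t) = r • BTensor.contractRight f t := by
  induction t using BTensor.induction with
  | h0 => simp
  | ht x y => simp [smul_comm]
  | ha s t hs ht => rw [smul_add, map_add, map_add, smul_add, hs, ht]

variable [Coring R C]

/-- The left linear map `c ↦ c₍₁₎ f(c₍₂₎)`. -/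
noncomputable def actLeft (f : LeftDual R C) : C →ₗ[R] C where
  toFun c := BTensor.contractRight f.toLin (Coring.comul (R := R) c)
  map_add' c d := by rw [map_add, map_add]
  map_smul' r c := by
    rw [map_smul, contractRight_smul]; rfl

/-- The multiplication `(f # g)(c) = g(c₍₁₎ f(c₍₂₎))`, with unit the counit. -/
noncomputable instance : Mul (LeftDual R C) := ⟨fun f g => g.toLin.comp f.actLeft⟩

noncomputable instance : One (LeftDual R C) := ⟨Coring.counit⟩

theorem mul_apply (f g : LeftDual R C) (c : C) :
    (f * g).toLin c = g.toLin (BTensor.contractRight f.toLin (Coring.comul (R := R) c)) := by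
  rfl

theorem one_apply (c : C) : (1 : LeftDual R C).toLin c = Coring.counit c := by
  rfl

theorem actLeft_mul (f g : LeftDual R C) (c : C) :
    (f * g).actLeft c = g.actLeft (f.actLeft c) := by
  let φ : BTensor R C (BTensor R C C) →+ C :=
    (BTensor.contractRight g.toLin).comp
      (BTensor.map LinearMap.id
        (⟨⟨BTensor.contractRight f.toLin, map_add _⟩, contractRight_smul f.toLin⟩ :
          BTensor R C C →ₗ[R] C))
  have h := congrArg φ (Coring.coassoc (R := R) c)
  have h1 : ∀ t : BTensor R C C, φ (BTensor.map LinearMap.id (Coring.comul (R := R)) t)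
      = BTensor.contractRight (f * g).toLin t := by
    intro t
    induction t using BTensor.induction with
    | h0 => simp
    | ht x y => simp [φ, mul_apply]
    | ha s t hs ht => rw [map_add, map_add, map_add, hs, ht]
  have h2 : ∀ t : BTensor R C C, φ (BTensor.assoc (BTensor.map (Coring.comulR R C) LinearMap.id t))
      = BTensor.contractRight g.toLin
        (Coring.comul (R := R) (BTensor.contractRight f.toLin t)) := by
    intro t
    induction t using BTensor.induction with
    | h0 => simp
    | ht x y =>
      have h3 : ∀ w : BTensor R C C, φ (BTensor.assoc (BTensor.tmul R w y))
          = BTensor.contractRight g.toLin (op (f.toLin y) • w) := by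
        intro w
        induction w using BTensor.induction with
        | h0 =>
          have h0 : BTensor.tmul R (0 : BTensor R C C) y = 0 := by
            have h := BTensor.add_tmul (R := R) (0 : BTensor R C C) 0 y
            rw [add_zero] at h
            simpa using h
          rw [h0]; simp
        | ht a b => simp [φ]
        | ha s t hs ht => rw [BTensor.add_tmul, map_add, map_add, hs, ht, smul_add, map_add]
      rw [BTensor.map_tmul, LinearMap.id_apply, h3, BTensor.contractRight_tmul,
        Coring.comul_op_smul]
      rfl
    | ha s t hs ht => simp only [map_add, hs, ht]
  rw [h1] at h
  exact h.symm.trans (h2 _)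

noncomputable instance : Ring (LeftDual R C) :=
  { (inferInstance : AddCommGroup (LeftDual R C)),
    (inferInstance : Mul (LeftDual R C)),
    (inferInstance : One (LeftDual R C)) with
    left_distrib := fun f g h => by apply LeftDual.ext; intro c; rfl
    right_distrib := fun f g h => by
      apply LeftDual.ext; intro c
      rw [toLin_add, LinearMap.add_apply, mul_apply, mul_apply, mul_apply, ← map_add]
      congr 1
      generalize Coring.comul (R := R) c = t
      induction t using BTensor.induction with
      | h0 => simp
      | ht x y => simp [toLin_add, add_smul]
      | ha s t hs ht => rw [map_add, map_add, map_add, hs, ht]; abel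
    zero_mul := fun f => by
      apply LeftDual.ext; intro c
      rw [mul_apply]
      have : BTensor.contractRight (LeftDual.toLin (0 : LeftDual R C))
          (Coring.comul (R := R) c) = 0 := by
        generalize Coring.comul (R := R) c = t
        induction t using BTensor.induction with
        | h0 => simp
        | ht x y => simp [toLin_zero]
        | ha s t hs ht => rw [map_add, hs, ht, add_zero]
      rw [this, map_zero, toLin_zero, LinearMap.zero_apply]
    mul_zero := fun f => by apply LeftDual.ext; intro c; rfl
    mul_assoc := fun f g h => by
      apply LeftDual.ext; intro c
      exact congrArg h.toLin (actLeft_mul f g c)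
    one_mul := fun f => by
      apply LeftDual.ext; intro c
      exact congrArg f.toLin (Coring.comul_counit (R := R) c)
    mul_one := fun f => by
      apply LeftDual.ext; intro c
      rw [mul_apply, one_apply]
      have h : ∀ t : BTensor R C C, Coring.counit (R := R) (BTensor.contractRight f.toLin t)
          = f.toLin (BTensor.contractLeft (Coring.counitR R C) t) := by
        intro t
        induction t using BTensor.induction with
        | h0 => simp
        | ht x y => simp [Coring.counit_op_smul, Coring.counitR]
        | ha s t hs ht => simp only [map_add, hs, ht]
      rw [h]
      exact congrArg f.toLin (Coring.counit_comul (R := R) c)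
    zsmul := fun n f => n • f
    zsmul_zero' := fun f => zero_zsmul f
    zsmul_succ' := fun n f => SubNegMonoid.zsmul_succ' n f
    zsmul_neg' := fun n f => SubNegMonoid.zsmul_neg' n f
    nsmul := fun n f => n • f
    nsmul_zero := fun f => zero_nsmul f
    nsmul_succ := fun n f => succ_nsmul f n
    neg_add_cancel := fun f => neg_add_cancel f
    sub_eq_add_neg := fun f g => sub_eq_add_neg f g }

end LeftDual

/-! ### Comodules -/

/-- A left `C`-comodule structure on the left `R`-module `M`. -/
class LeftComodule (R C M : Type*) [Ring R] [AddCommGroup C] [Module R C] [Module Rᵐᵒᵖ C]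
    [SMulCommClass R Rᵐᵒᵖ C] [Coring R C] [AddCommGroup M] [Module R M] where
  /-- The left coaction. -/
  coact : M →ₗ[R] BTensor R C M
  coact_coassoc : ∀ m : M,
    BTensor.assoc (BTensor.map (Coring.comulR R C) LinearMap.id (coact m)) =
      BTensor.map LinearMap.id coact (coact m)
  counit_coact : ∀ m : M, BTensor.contractLeft (Coring.counitR R C) (coact m) = m

/-- A right `C`-comodule structure on the right `R`-module `M`. -/
class RightComodule (R C M : Type*) [Ring R] [AddCommGroup C] [Module R C] [Module Rᵐᵒᵖ C]
    [SMulCommClass R Rᵐᵒᵖ C] [Coring R C] [AddCommGroup M] [Module Rᵐᵒᵖ M] where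
  /-- The right coaction. -/
  coact : M →ₗ[Rᵐᵒᵖ] BTensor R M C
  coact_coassoc : ∀ m : M,
    BTensor.assoc (BTensor.map coact LinearMap.id (coact m)) =
      BTensor.map LinearMap.id (Coring.comul (R := R)) (coact m)
  counit_coact : ∀ m : M, BTensor.contractRight (Coring.counit (R := R) (C := C)) (coact m) = m

/-- A coring is a left comodule over itself. -/
noncomputable instance Coring.toLeftComodule (R C : Type*) [Ring R] [AddCommGroup C] [Module R C]
    [Module Rᵐᵒᵖ C] [SMulCommClass R Rᵐᵒᵖ C] [Coring R C] : LeftComodule R C C where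
  coact := Coring.comul
  coact_coassoc := Coring.coassoc
  counit_coact := Coring.counit_comul

section Comodules

variable (R C : Type u) [Ring R] [AddCommGroup C] [Module R C] [Module Rᵐᵒᵖ C]
  [SMulCommClass R Rᵐᵒᵖ C] [Coring R C]

/-- Morphisms of left comodules: the left `R`-linear maps that respect the coactions. -/
def IsColinear {M M' : Type u} [AddCommGroup M] [Module R M] [LeftComodule R C M]
    [AddCommGroup M'] [Module R M'] [LeftComodule R C M'] (f : M →ₗ[R] M') : Prop :=
  ∀ m : M, LeftComodule.coact (R := R) (C := C) (f m) =
    BTensor.map LinearMap.id f (LeftComodule.coact m)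

/-- `X` is an injective object of the category of left comodules. Under the right `α`-condition
`C` is flat as a right module, so that the monomorphisms of left comodules are the injective
morphisms. -/
def IsInjectiveComodule (X : Type u) [AddCommGroup X] [Module R X] [LeftComodule R C X] : Prop :=
  ∀ (A B : Type u) [AddCommGroup A] [Module R A] [LeftComodule R C A]
    [AddCommGroup B] [Module R B] [LeftComodule R C B]
    (i : A →ₗ[R] B) (f : A →ₗ[R] X), IsColinear R C i → Function.Injective i → IsColinear R C f →
    ∃ g : B →ₗ[R] X, IsColinear R C g ∧ g.comp i = f

/-- A submodule `N` of a left comodule is a subcomodule if it has a comodule structure for which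
the inclusion is a morphism of comodules. -/
def IsSubcomodule {M : Type u} [AddCommGroup M] [Module R M] [LeftComodule R C M]
    (N : Submodule R M) : Prop :=
  ∃ _ : LeftComodule R C N, IsColinear R C N.subtype

/-- The simple subcomodules of a left comodule. -/
def IsSimpleSubcomodule {M : Type u} [AddCommGroup M] [Module R M] [LeftComodule R C M]
    (S : Submodule R M) : Prop :=
  IsSubcomodule R C S ∧ S ≠ ⊥ ∧
    ∀ N : Submodule R M, IsSubcomodule R C N → N ≤ S → N = ⊥ ∨ N = S

/-- The socle of a left comodule: the sum of its simple subcomodules. -/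
def comoduleSocle (M : Type u) [AddCommGroup M] [Module R M] [LeftComodule R C M] :
    Submodule R M :=
  sSup {S | IsSimpleSubcomodule R C S}

/-- `E` is an injective hull of the subcomodule `S` inside the left comodule `M`: it is a
subcomodule that contains `S`, it is injective as a left comodule, and `S` is essential in it. -/
structure IsInjectiveHullIn {M : Type u} [AddCommGroup M] [Module R M] [LeftComodule R C M]
    (S E : Submodule R M) : Prop where
  le : S ≤ E
  injective : ∃ _ : LeftComodule R C E, IsColinear R C E.subtype ∧ IsInjectiveComodule R C E
  essential : ∀ N : Submodule R M, IsSubcomodule R C N → N ≤ E → N ⊓ S = ⊥ → N = ⊥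

/-- The subcomodule `N` is finitely generated as a comodule: it is the smallest subcomodule that
contains some finite subset of it. -/
def IsFGSubcomodule {M : Type u} [AddCommGroup M] [Module R M] [LeftComodule R C M]
    (N : Submodule R M) : Prop :=
  IsSubcomodule R C N ∧ ∃ t : Finset M, (t : Set M) ⊆ N ∧
    ∀ K : Submodule R M, IsSubcomodule R C K → (t : Set M) ⊆ K → N ≤ K

/-- The left comodule `M` is locally artinian in the category of left comodules: every finitely
generated subcomodule satisfies the descending chain condition on subcomodules. -/
def IsLocallyArtinianComodule (M : Type u) [AddCommGroup M] [Module R M] [LeftComodule R C M] :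
    Prop :=
  ∀ N : Submodule R M, IsFGSubcomodule R C N →
    WellFoundedLT {K : Submodule R M // IsSubcomodule R C K ∧ K ≤ N}

/-- The left module `M` is locally artinian: its finitely generated submodules are artinian. -/
def IsLocallyArtinianModule (M : Type u) [AddCommGroup M] [Module R M] : Prop :=
  ∀ N : Submodule R M, N.FG → IsArtinian R N

/-! ### The functor `Rat`

Right modules over the ring `{}^*C` are `(LeftDual R C)ᵐᵒᵖ`-modules. -/

/-- The submodule `N` of the right `{}^*C`-module `M` is rational: it has a right `C`-coaction
`n ↦ n₍₀₎ ⊗ n₍₁₎` such that `n · f = n₍₀₎ f(n₍₁₎)` for all `f` in `{}^*C`. The right `R`-module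
structure that carries the coaction is then `n · r = n · (c ↦ ε(c) r)`, by the counit law. -/
def IsRationalSubmodule {M : Type u} [AddCommGroup M] [Module (LeftDual R C)ᵐᵒᵖ M]
    (N : Submodule (LeftDual R C)ᵐᵒᵖ M) : Prop :=
  ∃ (_ : Module Rᵐᵒᵖ N) (_ : RightComodule R C N), ∀ (n : N) (f : LeftDual R C),
    op f • n = BTensor.contractRight f.toLin (RightComodule.coact (R := R) (C := C) n)

/-- `Rat^C(M)`, the largest rational submodule of the right `{}^*C`-module `M`. -/
noncomputable def ratSubmodule (M : Type u) [AddCommGroup M] [Module (LeftDual R C)ᵐᵒᵖ M] :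
    Submodule (LeftDual R C)ᵐᵒᵖ M :=
  sSup {N | IsRationalSubmodule R C N}

/-- The functor `Rat^C` is exact: for every short exact sequence `0 → X → Y → Z → 0` of right
`{}^*C`-modules, the sequence `0 → Rat(X) → Rat(Y) → Rat(Z) → 0` of restricted maps is exact. -/
def RatIsExact : Prop :=
  ∀ (X Y Z : Type u) [AddCommGroup X] [AddCommGroup Y] [AddCommGroup Z]
    [Module (LeftDual R C)ᵐᵒᵖ X] [Module (LeftDual R C)ᵐᵒᵖ Y] [Module (LeftDual R C)ᵐᵒᵖ Z]
    (f : X →ₗ[(LeftDual R C)ᵐᵒᵖ] Y) (g : Y →ₗ[(LeftDual R C)ᵐᵒᵖ] Z),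
    Function.Injective f → Function.Exact f g → Function.Surjective g →
    (ratSubmodule R C X).map f = ratSubmodule R C Y ⊓ LinearMap.ker g ∧
      (ratSubmodule R C Y).map g = ratSubmodule R C Z

end Comodules

/-! The map `f.actLeft`, `c ↦ c₍₁₎ f(c₍₂₎)`, makes `C` a right module over `{}^*C`, and `f ↦
f.actLeft` identifies `{}^*C` with the left colinear endomorphisms of `C`, where `f * g` means first
`f`, then `g` (`LeftDual.isColinear_actLeft`, `LeftDual.exists_actLeft_eq`). The left `α`-condition
describes `Rat` by annihilators: `m` is rational iff it is killed by every `f` that kills some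
finite subset `F` of `C` (`ratSubmodule_eq`). The right `α`-condition identifies subcomodules of
left comodules with submodules stable under `C^*`, and colinear maps with `C^*`-linear ones.

Exactness of `Rat` is a statement about rational elements of `{}^*C`. If some rational `t` fixes `F`
pointwise and `z` is killed by the annihilator of `F`, then `z = z · t`. For any lift `y` of `z`,
the element `y · t` is a rational lift (`ratIsExact_of_exists`). Conversely, exactness applied to
`{}^*C → x · {}^*C` lifts `x` to a rational `t` with `x · t = x` (`RatIsExact.exists_actLeft_eq`).

If `Rat` is exact, take such a `t` for a nonzero `x` in the simple `S`. The kernel of `t` meets `S`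
trivially, hence also `E(S)` by essentiality. Injectivity of `E(S)` gives an endomorphism `e` of `C`
with image in `E(S)` that undoes `t` on `E(S)`. A rational `t` has image in a finitely generated
module `L`, so `E(S) = e(L)` is finitely generated.

If all `E(S i)` are finitely generated, let `N` be the subcomodule generated by `F`. By injectivity
of `C`, the projections of the socle onto the `S i` extend to endomorphisms `a i`. Let `e i` be a
retraction onto `E(S i)`; it is rational. The chain condition gives a finite `J` for which the `a j`
detect all of `N ∩ socle`. Then `p = ∑ a j * e j` is rational and injective on `N ∩ socle`, hence on
`N`, since a nonzero kernel would contain a simple subcomodule. Injectivity of `C` gives `b` undoing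
`p` on `N`, and `p * b` is rational and fixes `F` (`exists_isRationalElement_fixing`). -/

namespace BTensor

/-! ### Right exactness of the tensor product -/

section Exactness

variable {R N M : Type*} [Ring R] [AddCommGroup N] [Module Rᵐᵒᵖ N]
  [AddCommGroup M] [Module R M]

theorem zero_tmul (y : M) : tmul R (0 : N) y = 0 := by
  have h := add_tmul (R := R) (0 : N) 0 y
  rw [add_zero] at h
  simpa using h

theorem tmul_zero (x : N) : tmul R x (0 : M) = 0 := by
  have h := tmul_add (R := R) x (0 : M) 0
  rw [add_zero] at h
  simpa using h

theorem map_map {N' N'' M' M'' : Type*} [AddCommGroup N'] [Module Rᵐᵒᵖ N'] [AddCommGroup N'']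
    [Module Rᵐᵒᵖ N''] [AddCommGroup M'] [Module R M'] [AddCommGroup M''] [Module R M'']
    (f : N →ₗ[Rᵐᵒᵖ] N') (f' : N' →ₗ[Rᵐᵒᵖ] N'') (g : M →ₗ[R] M') (g' : M' →ₗ[R] M'')
    (t : BTensor R N M) : map f' g' (map f g t) = map (f'.comp f) (g'.comp g) t := by
  induction t using BTensor.induction with
  | h0 => simp
  | ht x y => simp
  | ha s t hs ht => simp only [map_add, hs, ht]

/-- Every tensor is a finite sum of pure tensors. -/
theorem exists_sum (t : BTensor R N M) :
    ∃ (n : ℕ) (x : Fin n → N) (y : Fin n → M), t = ∑ i, tmul R (x i) (y i) := by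
  induction t using BTensor.induction with
  | h0 => exact ⟨0, Fin.elim0, Fin.elim0, by simp⟩
  | ht x y => exact ⟨1, fun _ => x, fun _ => y, by simp⟩
  | ha s t hs ht =>
    obtain ⟨n, x, y, rfl⟩ := hs
    obtain ⟨m, x', y', rfl⟩ := ht
    exact ⟨n + m, Fin.append x x', Fin.append y y', by simp [Fin.sum_univ_add]⟩

/-- Right exactness of `N ⊗_R -`. -/
theorem exists_map_subtype_right (M' : Submodule R M) (t : BTensor R N M)
    (h : map LinearMap.id M'.mkQ t = 0) :
    ∃ t' : BTensor R N M', map LinearMap.id M'.subtype t' = t := by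
  let P : AddSubgroup (BTensor R N M) := (map LinearMap.id M'.subtype).range
  let q : M →+ M ⧸ M' := M'.mkQ.toAddMonoidHom
  have hq : Function.Surjective q := M'.mkQ_surjective
  let β (x : N) : M →+ BTensor R N M ⧸ P :=
    (QuotientAddGroup.mk' P).comp (AddMonoidHom.mk' (tmul R x) (tmul_add x))
  have hβ (x : N) : q.ker ≤ (β x).ker := by
    intro y hy
    have hy' : y ∈ M' := by
      have h0 : M'.mkQ y = 0 := hy
      simpa using h0
    exact (QuotientAddGroup.eq_zero_iff _).2 ⟨tmul R x ⟨y, hy'⟩, rfl⟩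
  let γ (x : N) : M ⧸ M' →+ BTensor R N M ⧸ P := q.liftOfSurjective hq ⟨β x, hβ x⟩
  have hγ (x : N) (y : M) : γ x (M'.mkQ y) = QuotientAddGroup.mk' P (tmul R x y) :=
    q.liftOfRightInverse_comp_apply _ _ ⟨β x, hβ x⟩ y
  -- `ψ` sends `x ⊗ [y]` to the class of `x ⊗ y` modulo the image `P` of `N ⊗ M'`, so whatever dies
  -- in `N ⊗ (M ⧸ M')` lies in `P`.
  let ψ : BTensor R N (M ⧸ M') →+ BTensor R N M ⧸ P :=
    lift (AddMonoidHom.mk' γ (by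
      intro x x'
      ext z
      obtain ⟨y, rfl⟩ := M'.mkQ_surjective z
      rw [AddMonoidHom.add_apply, hγ, hγ, hγ, add_tmul, map_add])) (by
      intro x r z
      obtain ⟨y, rfl⟩ := M'.mkQ_surjective z
      rw [← map_smul]
      change γ _ _ = γ _ _
      rw [hγ, hγ, smul_tmul])
  have hψ : ∀ t, ψ (map LinearMap.id M'.mkQ t) = QuotientAddGroup.mk' P t := by
    intro t
    induction t using BTensor.induction with
    | h0 => simp
    | ht x y => rw [map_tmul, lift_tmul]; exact hγ x y
    | ha s t hs ht => simp only [map_add, hs, ht]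
  have := hψ t
  rw [h, map_zero] at this
  exact (QuotientAddGroup.eq_zero_iff _).1 this.symm

/-- Right exactness of `- ⊗_R M`. -/
theorem exists_map_subtype_left (N' : Submodule Rᵐᵒᵖ N) (t : BTensor R N M)
    (h : map N'.mkQ LinearMap.id t = 0) :
    ∃ t' : BTensor R N' M, map N'.subtype LinearMap.id t' = t := by
  let P : AddSubgroup (BTensor R N M) := (map N'.subtype LinearMap.id).range
  let q : N →+ N ⧸ N' := N'.mkQ.toAddMonoidHom
  have hq : Function.Surjective q := N'.mkQ_surjective
  let β (y : M) : N →+ BTensor R N M ⧸ P :=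
    (QuotientAddGroup.mk' P).comp
      (AddMonoidHom.mk' (fun x => tmul R x y) (fun x x' => add_tmul x x' y))
  have hβ (y : M) : q.ker ≤ (β y).ker := by
    intro x hx
    have hx' : x ∈ N' := by
      have h0 : N'.mkQ x = 0 := hx
      simpa using h0
    exact (QuotientAddGroup.eq_zero_iff _).2 ⟨tmul R ⟨x, hx'⟩ y, rfl⟩
  let γ (y : M) : N ⧸ N' →+ BTensor R N M ⧸ P := q.liftOfSurjective hq ⟨β y, hβ y⟩
  have hγ (x : N) (y : M) : γ y (N'.mkQ x) = QuotientAddGroup.mk' P (tmul R x y) :=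
    q.liftOfRightInverse_comp_apply _ _ ⟨β y, hβ y⟩ x
  let ψ : BTensor R (N ⧸ N') M →+ BTensor R N M ⧸ P :=
    lift (AddMonoidHom.mk' γ (by
      intro y y'
      ext z
      obtain ⟨x, rfl⟩ := N'.mkQ_surjective z
      rw [AddMonoidHom.add_apply, hγ, hγ, hγ, tmul_add, map_add])).flip (by
      intro z r y
      obtain ⟨x, rfl⟩ := N'.mkQ_surjective z
      rw [← map_smul]
      change γ _ _ = γ _ _
      rw [hγ, hγ, smul_tmul])
  have hψ : ∀ t, ψ (map N'.mkQ LinearMap.id t) = QuotientAddGroup.mk' P t := by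
    intro t
    induction t using BTensor.induction with
    | h0 => simp
    | ht x y => rw [map_tmul, lift_tmul]; exact hγ x y
    | ha s t hs ht => simp only [map_add, hs, ht]
  have := hψ t
  rw [h, map_zero] at this
  exact (QuotientAddGroup.eq_zero_iff _).1 this.symm

end Exactness

section Naturality

variable {R N N' M M' C : Type*} [Ring R] [AddCommGroup N] [Module Rᵐᵒᵖ N]
  [AddCommGroup N'] [Module Rᵐᵒᵖ N'] [AddCommGroup M] [Module R M]
  [AddCommGroup M'] [Module R M'] [AddCommGroup C]

theorem contractRight_map [Module R C] (φ : N →ₗ[Rᵐᵒᵖ] N') (f : C →ₗ[R] R) (t : BTensor R N C) :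
    contractRight f (map φ LinearMap.id t) = φ (contractRight f t) := by
  induction t using BTensor.induction with
  | h0 => simp
  | ht x y => simp
  | ha s t hs ht => simp only [map_add, hs, ht]

theorem contractLeft_map [Module Rᵐᵒᵖ C] (φ : M →ₗ[R] M') (f : C →ₗ[Rᵐᵒᵖ] R)
    (t : BTensor R C M) :
    contractLeft f (map LinearMap.id φ t) = φ (contractLeft f t) := by
  induction t using BTensor.induction with
  | h0 => simp
  | ht x y => simp
  | ha s t hs ht => simp only [map_add, hs, ht]

end Naturality

/-! ### Consequences of the `α`-conditions -/

section RightAlpha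

variable {R C : Type u} [Ring R] [AddCommGroup C] [Module Rᵐᵒᵖ C]
  {M M' : Type u} [AddCommGroup M] [Module R M] [AddCommGroup M'] [Module R M']

theorem ext_of_rightAlpha (h : RightAlpha R C) {s t : BTensor R C M}
    (hst : ∀ f : C →ₗ[Rᵐᵒᵖ] R, contractLeft f s = contractLeft f t) : s = t :=
  h M (funext hst)

/-- Under the right `α`-condition, `C ⊗_R -` preserves injectivity. -/
theorem map_injective_of_rightAlpha (h : RightAlpha R C) (φ : M →ₗ[R] M')
    (hφ : Function.Injective φ) :
    Function.Injective (map (R := R) (LinearMap.id : C →ₗ[Rᵐᵒᵖ] C) φ) := by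
  intro s t hst
  refine ext_of_rightAlpha h fun f => hφ ?_
  rw [← contractLeft_map, ← contractLeft_map, hst]

/-- The image of `t` in `C ⊗ (M ⧸ M')` is annihilated by all right forms, hence vanishes by the
`α`-condition; right exactness then supplies `t'`. -/
theorem exists_of_contractLeft_mem (h : RightAlpha R C) (M' : Submodule R M) (t : BTensor R C M)
    (ht : ∀ f : C →ₗ[Rᵐᵒᵖ] R, contractLeft f t ∈ M') :
    ∃ t' : BTensor R C M', map LinearMap.id M'.subtype t' = t := by
  refine exists_map_subtype_right M' t (ext_of_rightAlpha h fun f => ?_)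
  rw [contractLeft_map, map_zero]
  simpa using ht f

end RightAlpha

section LeftAlpha

variable {R C : Type u} [Ring R] [AddCommGroup C] [Module R C]
  {N : Type u} [AddCommGroup N] [Module Rᵐᵒᵖ N]

theorem ext_of_leftAlpha (h : LeftAlpha R C) {s t : BTensor R N C}
    (hst : ∀ f : C →ₗ[R] R, contractRight f s = contractRight f t) : s = t :=
  h N (funext hst)

theorem exists_of_contractRight_mem (h : LeftAlpha R C) (N' : Submodule Rᵐᵒᵖ N)
    (t : BTensor R N C) (ht : ∀ f : C →ₗ[R] R, contractRight f t ∈ N') :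
    ∃ t' : BTensor R N' C, map N'.subtype LinearMap.id t' = t := by
  refine exists_map_subtype_left N' t (ext_of_leftAlpha h fun f => ?_)
  rw [contractRight_map, map_zero]
  simpa using ht f

/-- Under the left `α`-condition, the left linear forms separate the points of `C`. -/
theorem _root_.LeftAlpha.eq_of_forall (h : LeftAlpha R C) {c d : C}
    (hcd : ∀ f : C →ₗ[R] R, f c = f d) : c = d := by
  -- The `α`-condition for `N = R`, transported to `C` by the multiplication map `μ`.
  have h1 : tmul R (1 : R) c = tmul R (1 : R) d :=
    ext_of_leftAlpha h fun f => by simp [hcd f]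
  let μ : BTensor R R C →+ C :=
    lift (AddMonoidHom.mk' (fun r => AddMonoidHom.mk' (fun c => r • c) (smul_add r))
      (fun r s => AddMonoidHom.ext fun c => add_smul r s c)) (fun r s c => mul_smul r s c)
  have h2 : (1 : R) • c = (1 : R) • d := congrArg μ h1
  simpa using h2

end LeftAlpha

end BTensor

/-! ### Left comodules as modules over the right dual -/

section DualAction

variable {R C : Type u} [Ring R] [AddCommGroup C] [Module R C] [Module Rᵐᵒᵖ C]
  [SMulCommClass R Rᵐᵒᵖ C] [Coring R C]
  {M M' : Type u} [AddCommGroup M] [Module R M] [LeftComodule R C M]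
  [AddCommGroup M'] [Module R M'] [LeftComodule R C M']

omit [Coring R C] in
theorem contractLeft_op_smul (f : C →ₗ[Rᵐᵒᵖ] R) (s : Rᵐᵒᵖ) (t : BTensor R C C) :
    BTensor.contractLeft f (s • t) = s • BTensor.contractLeft f t := by
  induction t using BTensor.induction with
  | h0 => simp
  | ht x y => simp [smul_comm]
  | ha s t hs ht => rw [smul_add, map_add, map_add, smul_add, hs, ht]

/-- The action `m ↦ f(m₍₋₁₎) m₍₀₎` of a right linear form on a left comodule. -/
noncomputable def dualAct (f : C →ₗ[Rᵐᵒᵖ] R) (m : M) : M :=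
  BTensor.contractLeft f (LeftComodule.coact (R := R) (C := C) m)

theorem dualAct_add (f : C →ₗ[Rᵐᵒᵖ] R) (m n : M) :
    dualAct f (m + n) = dualAct f m + dualAct f n := by
  simp only [dualAct, map_add]

theorem dualAct_zero (f : C →ₗ[Rᵐᵒᵖ] R) : dualAct f (0 : M) = 0 := by
  simp only [dualAct, map_zero]

theorem dualAct_counit (m : M) : dualAct (Coring.counitR R C) m = m :=
  LeftComodule.counit_coact m

theorem add_dualAct (f g : C →ₗ[Rᵐᵒᵖ] R) (m : M) :
    dualAct (f + g) m = dualAct f m + dualAct g m := by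
  simp only [dualAct]
  generalize LeftComodule.coact (R := R) (C := C) m = t
  induction t using BTensor.induction with
  | h0 => simp
  | ht x y => simp [add_smul]
  | ha s t hs ht => simp only [map_add, hs, ht]; abel

theorem zero_dualAct (m : M) : dualAct (0 : C →ₗ[Rᵐᵒᵖ] R) m = 0 := by
  simp only [dualAct]
  generalize LeftComodule.coact (R := R) (C := C) m = t
  induction t using BTensor.induction with
  | h0 => simp
  | ht x y => simp
  | ha s t hs ht => simp only [map_add, hs, ht, add_zero]

theorem smul_dualAct (r : R) (f : C →ₗ[Rᵐᵒᵖ] R) (m : M) :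
    dualAct (r • f) m = r • dualAct f m := by
  simp only [dualAct]
  generalize LeftComodule.coact (R := R) (C := C) m = t
  induction t using BTensor.induction with
  | h0 => simp
  | ht x y => simp [mul_smul]
  | ha s t hs ht => simp only [map_add, hs, ht, smul_add]

/-- The convolution `c ↦ f(g(c₍₁₎) c₍₂₎)` of right linear forms. -/
noncomputable def dualComp (f g : C →ₗ[Rᵐᵒᵖ] R) : C →ₗ[Rᵐᵒᵖ] R where
  toFun c := f (BTensor.contractLeft g (Coring.comulR R C c))
  map_add' c d := by simp only [map_add]
  map_smul' s c := by
    rw [map_smul, contractLeft_op_smul, map_smul, RingHom.id_apply]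

/-- By coassociativity, applying `g` and then `f` to the coaction is the same as applying their
convolution once. Hence the orbit of an element under `C^*` is stable. -/
theorem dualAct_dualAct (f g : C →ₗ[Rᵐᵒᵖ] R) (m : M) :
    dualAct f (dualAct g m) = dualAct (dualComp f g) m := by
  have h1 : ∀ t : BTensor R C M,
      LeftComodule.coact (R := R) (C := C) (BTensor.contractLeft g t)
        = BTensor.contractLeft g (BTensor.map LinearMap.id (LeftComodule.coact (C := C)) t) := by
    intro t
    rw [BTensor.contractLeft_map]
  have h2 : ∀ (w : BTensor R C C) (y : M),
      BTensor.contractLeft f (BTensor.contractLeft g (BTensor.assoc (BTensor.tmul R w y)))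
        = f (BTensor.contractLeft g w) • y := by
    intro w y
    induction w using BTensor.induction with
    | h0 => rw [BTensor.zero_tmul]; simp
    | ht a b => simp
    | ha s t hs ht => rw [BTensor.add_tmul]; simp only [map_add, hs, ht, add_smul]
  have h3 : ∀ t : BTensor R C M, BTensor.contractLeft f (BTensor.contractLeft g
      (BTensor.assoc (BTensor.map (Coring.comulR R C) LinearMap.id t)))
        = BTensor.contractLeft (dualComp f g) t := by
    intro t
    induction t using BTensor.induction with
    | h0 => simp
    | ht x y => rw [BTensor.map_tmul, h2]; rfl
    | ha s t hs ht => simp only [map_add, hs, ht]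
  rw [dualAct, dualAct, h1, ← LeftComodule.coact_coassoc, h3, dualAct]

theorem IsColinear.map_dualAct {φ : M →ₗ[R] M'} (h : IsColinear R C φ) (f : C →ₗ[Rᵐᵒᵖ] R)
    (m : M) : φ (dualAct f m) = dualAct f (φ m) := by
  rw [dualAct, dualAct, h m, BTensor.contractLeft_map]

/-- Right forms separate the points of `C ⊗ M'`, so colinearity can be tested after contraction with
each form. -/
theorem isColinear_of_map_dualAct (hright : RightAlpha R C) {φ : M →ₗ[R] M'}
    (h : ∀ (f : C →ₗ[Rᵐᵒᵖ] R) (m : M), φ (dualAct f m) = dualAct f (φ m)) :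
    IsColinear R C φ := fun m =>
  BTensor.ext_of_rightAlpha hright fun f => by
    rw [BTensor.contractLeft_map]
    exact (h f m).symm

variable (C) in
/-- Under the right `α`-condition, the submodules of a left comodule that are stable under the
right dual are its subcomodules. -/
def DualStable (N : Submodule R M) : Prop :=
  ∀ (f : C →ₗ[Rᵐᵒᵖ] R), ∀ m ∈ N, dualAct f m ∈ N

theorem IsSubcomodule.dualStable {N : Submodule R M} (h : IsSubcomodule R C N) :
    DualStable C N := by
  obtain ⟨_, hN⟩ := h
  intro f m hm
  have := hN.map_dualAct f ⟨m, hm⟩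
  exact this ▸ (dualAct f (⟨m, hm⟩ : N)).2

/-- Stability says that all contractions of the coaction of `n ∈ N` lie in `N`, so the `α`-condition
places that coaction in the image of `C ⊗ N`. As `C ⊗ N` embeds in `C ⊗ M`, the restricted coaction
is unique and inherits the axioms. -/
theorem DualStable.isSubcomodule (hright : RightAlpha R C) {N : Submodule R M}
    (h : DualStable C N) : IsSubcomodule R C N := by
  let j : BTensor R C N →+ BTensor R C M := BTensor.map LinearMap.id N.subtype
  have hj : Function.Injective j :=
    BTensor.map_injective_of_rightAlpha hright _ N.injective_subtype
  have hex (n : N) : ∃ t : BTensor R C N, j t = LeftComodule.coact (n : M) :=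
    BTensor.exists_of_contractLeft_mem hright N _ fun f => h f n n.2
  choose δ hδ using hex
  have hjs (r : R) (t : BTensor R C N) : j (r • t) = r • j t := by
    induction t using BTensor.induction with
    | h0 => simp
    | ht x y => simp [j]
    | ha s t hs ht => simp only [smul_add, map_add, hs, ht]
  let Δ : N →ₗ[R] BTensor R C N :=
    { toFun := δ
      map_add' := fun m n => hj (by rw [map_add, hδ, hδ, hδ, Submodule.coe_add, map_add])
      map_smul' := fun r n => hj (by
        rw [RingHom.id_apply, hjs, hδ, hδ, Submodule.coe_smul, map_smul]) }
  have hΔ (n : N) : BTensor.map LinearMap.id N.subtype (Δ n) = LeftComodule.coact (n : M) := hδ n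
  let jj : BTensor R C N →ₗ[R] BTensor R C M := ⟨⟨j, map_add j⟩, hjs⟩
  -- Coassociativity is checked in `C ⊗ (C ⊗ M)`, into which `C ⊗ (C ⊗ N)` embeds.
  have hjj : Function.Injective (BTensor.map (R := R) (LinearMap.id : C →ₗ[Rᵐᵒᵖ] C) jj) :=
    BTensor.map_injective_of_rightAlpha hright _ hj
  have hassoc (t : BTensor R (BTensor R C C) N) :
      BTensor.map LinearMap.id jj (BTensor.assoc t)
        = BTensor.assoc (BTensor.map LinearMap.id N.subtype t) := by
    induction t using BTensor.induction with
    | h0 => simp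
    | ht w y =>
      induction w using BTensor.induction with
      | h0 => simp [BTensor.zero_tmul]
      | ht a b => simp [jj, j]
      | ha s t hs ht => simp only [BTensor.add_tmul, map_add, hs, ht]
    | ha s t hs ht => simp only [map_add, hs, ht]
  refine ⟨⟨Δ, fun n => hjj ?_, fun n => N.injective_subtype ?_⟩, fun n => (hΔ n).symm⟩
  · rw [hassoc, BTensor.map_map, BTensor.map_map]
    have e1 : jj.comp Δ = (LeftComodule.coact (R := R) (C := C) (M := M)).comp N.subtype :=
      LinearMap.ext hΔ
    rw [e1]
    have h1 := LeftComodule.coact_coassoc (R := R) (C := C) (n : M)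
    rw [← hΔ, BTensor.map_map, BTensor.map_map] at h1
    exact h1
  · rw [← BTensor.contractLeft_map, hΔ]
    exact LeftComodule.counit_coact _

theorem DualStable.iSup {ι : Sort*} {N : ι → Submodule R M} (h : ∀ i, DualStable C (N i)) :
    DualStable C (⨆ i, N i) := by
  intro f m hm
  refine Submodule.iSup_induction N (motive := fun m => dualAct f m ∈ ⨆ i, N i) hm
    (fun i x hx => Submodule.mem_iSup_of_mem i (h i f x hx)) ?_ ?_
  · rw [dualAct_zero]; exact zero_mem _
  · intro x y hx hy
    rw [dualAct_add]; exact add_mem hx hy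

theorem DualStable.inf {N N' : Submodule R M} (h : DualStable C N) (h' : DualStable C N') :
    DualStable C (N ⊓ N') := fun f m hm => ⟨h f m hm.1, h' f m hm.2⟩

theorem DualStable.sup {N N' : Submodule R M} (h : DualStable C N) (h' : DualStable C N') :
    DualStable C (N ⊔ N') := by
  intro f m hm
  obtain ⟨x, hx, y, hy, rfl⟩ := Submodule.mem_sup.1 hm
  rw [dualAct_add]
  exact Submodule.add_mem_sup (h f x hx) (h' f y hy)

theorem DualStable.ker_of_isColinear {φ : M →ₗ[R] M'} (h : IsColinear R C φ) :
    DualStable C (LinearMap.ker φ) := by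
  intro f m hm
  rw [LinearMap.mem_ker] at hm ⊢
  rw [h.map_dualAct, hm, dualAct_zero]

variable (R C) in
/-- The subcomodule generated by an element. -/
noncomputable def cyclicSubcomodule (m : M) : Submodule R M where
  carrier := Set.range fun f : C →ₗ[Rᵐᵒᵖ] R => dualAct f m
  add_mem' := by
    rintro _ _ ⟨f, rfl⟩ ⟨g, rfl⟩
    exact ⟨f + g, add_dualAct f g m⟩
  zero_mem' := ⟨0, zero_dualAct m⟩
  smul_mem' := by
    rintro r _ ⟨f, rfl⟩
    exact ⟨r • f, smul_dualAct r f m⟩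

variable (R C) in
/-- The subcomodule generated by a finite set. -/
noncomputable def generatedSubcomodule (t : Finset M) : Submodule R M :=
  ⨆ m : t, cyclicSubcomodule R C (m : M)

theorem dualStable_generatedSubcomodule (t : Finset M) :
    DualStable C (generatedSubcomodule R C t) := by
  refine DualStable.iSup fun m => ?_
  rintro f _ ⟨g, rfl⟩
  exact ⟨dualComp f g, (dualAct_dualAct f g _).symm⟩

theorem subset_generatedSubcomodule (t : Finset M) :
    (t : Set M) ⊆ generatedSubcomodule R C t := fun m hm =>
  Submodule.mem_iSup_of_mem (p := fun m : t => cyclicSubcomodule R C (m : M)) ⟨m, hm⟩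
    ⟨Coring.counitR R C, dualAct_counit m⟩

theorem generatedSubcomodule_le {t : Finset M} {K : Submodule R M} (hK : DualStable C K)
    (ht : (t : Set M) ⊆ K) : generatedSubcomodule R C t ≤ K := by
  refine iSup_le fun m => ?_
  rintro _ ⟨f, rfl⟩
  exact hK f m (ht m.2)

theorem isFGSubcomodule_generatedSubcomodule (hright : RightAlpha R C) (t : Finset M) :
    IsFGSubcomodule R C (generatedSubcomodule R C t) :=
  ⟨(dualStable_generatedSubcomodule t).isSubcomodule hright, t, subset_generatedSubcomodule t,
    fun _ hK => generatedSubcomodule_le hK.dualStable⟩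

/-- A finitely generated comodule is contained in a finitely generated module. -/
theorem exists_fg_generatedSubcomodule_le (t : Finset M) :
    ∃ L : Submodule R M, L.FG ∧ generatedSubcomodule R C t ≤ L := by
  have h (m : M) : ∃ L : Submodule R M, L.FG ∧ cyclicSubcomodule R C m ≤ L := by
    obtain ⟨n, x, y, hxy⟩ := BTensor.exists_sum (LeftComodule.coact (R := R) (C := C) m)
    refine ⟨Submodule.span R (Set.range y), Submodule.fg_span (Set.finite_range y), ?_⟩
    rintro _ ⟨f, rfl⟩
    simp only [dualAct, hxy, map_sum, BTensor.contractLeft_tmul]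
    exact Submodule.sum_mem _ fun i _ =>
      Submodule.smul_mem _ _ (Submodule.subset_span ⟨i, rfl⟩)
  choose L hL hle using h
  exact ⟨⨆ m : t, L m, Submodule.fg_iSup _ fun m => hL m, iSup_mono fun m => hle m⟩

theorem IsFGSubcomodule.exists_fg_le (hright : RightAlpha R C) {N : Submodule R M}
    (hN : IsFGSubcomodule R C N) : ∃ L : Submodule R M, L.FG ∧ N ≤ L := by
  obtain ⟨-, t, -, ht⟩ := hN
  obtain ⟨L, hL, hle⟩ := exists_fg_generatedSubcomodule_le (R := R) (C := C) t
  exact ⟨L, hL, (ht _ ((dualStable_generatedSubcomodule t).isSubcomodule hright)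
    (subset_generatedSubcomodule t)).trans hle⟩

/-- A subcomodule that is finitely generated as a module is finitely generated. -/
theorem IsSubcomodule.isFG {N : Submodule R M} (hN : IsSubcomodule R C N) (h : N.FG) :
    IsFGSubcomodule R C N := by
  obtain ⟨t, rfl⟩ := h
  exact ⟨hN, t, Submodule.subset_span, fun K _ ht => Submodule.span_le.2 ht⟩

/-- Finitely generated subcomodules satisfy the descending chain condition under each of the three
finiteness conditions. -/
theorem isLocallyArtinianComodule_of_or (hright : RightAlpha R C)
    (h : IsArtinianRing R ∨ IsLocallyArtinianModule R M ∨ IsLocallyArtinianComodule R C M) :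
    IsLocallyArtinianComodule R C M := by
  have key (h : IsLocallyArtinianModule R M) : IsLocallyArtinianComodule R C M := by
    intro N hN
    obtain ⟨L, hL, hle⟩ := hN.exists_fg_le hright
    have := h L hL
    -- Subcomodules of `N` are submodules of the artinian module `L`; `K ↦ K.comap L.subtype` is
    -- strict because `K ≤ N ≤ L`.
    let φ : {K : Submodule R M // IsSubcomodule R C K ∧ K ≤ N} → Submodule R L :=
      fun K => K.1.comap L.subtype
    have hφ : StrictMono φ := by
      intro K K' hlt
      refine lt_of_le_of_ne (Submodule.comap_mono hlt.le) fun heq => hlt.ne (Subtype.ext ?_)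
      have := congrArg (Submodule.map L.subtype) heq
      rwa [Submodule.map_comap_subtype, Submodule.map_comap_subtype,
        inf_eq_right.2 (K.2.2.trans hle), inf_eq_right.2 (K'.2.2.trans hle)] at this
    exact hφ.wellFoundedLT
  rcases h with h | h | h
  · exact key fun N hN => isArtinian_of_fg_of_artinian N hN
  · exact key h
  · exact h

end DualAction

/-! ### Rebracketing triple tensors -/

namespace BTensor

variable {R N B M : Type*} [Ring R] [AddCommGroup N] [Module Rᵐᵒᵖ N]
  [AddCommGroup B] [Module R B] [Module Rᵐᵒᵖ B] [SMulCommClass R Rᵐᵒᵖ B]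
  [AddCommGroup M] [Module R M]

/-- The map `t ↦ (x ⊗ b) ⊗ y` for fixed `x`, where `t = b ⊗ y`. -/
noncomputable def assocSymmAux (x : N) : BTensor R B M →+ BTensor R (BTensor R N B) M :=
  lift
    (AddMonoidHom.mk'
      (fun b => AddMonoidHom.mk' (fun y => tmul R (tmul R x b) y) (tmul_add _))
      (fun b b' => AddMonoidHom.ext fun y => by
        simp only [AddMonoidHom.mk'_apply, AddMonoidHom.add_apply, tmul_add, add_tmul]))
    (fun b r y => by
      simp only [AddMonoidHom.mk'_apply]
      rw [← op_smul_tmul, smul_tmul])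

theorem assocSymmAux_tmul (x : N) (b : B) (y : M) :
    assocSymmAux x (tmul R b y) = tmul R (tmul R x b) y := by
  rfl

/-- The canonical map `N ⊗_R (B ⊗_R M) → (N ⊗_R B) ⊗_R M`. -/
noncomputable def assocSymm : BTensor R N (BTensor R B M) →+ BTensor R (BTensor R N B) M :=
  lift
    (AddMonoidHom.mk' assocSymmAux (fun x x' => hom_ext fun b y => by
      rw [AddMonoidHom.add_apply, assocSymmAux_tmul, assocSymmAux_tmul, assocSymmAux_tmul,
        add_tmul, add_tmul]))
    (fun x r t => by
      simp only [AddMonoidHom.mk'_apply]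
      induction t using BTensor.induction with
      | h0 => simp
      | ht b y => rw [smul_tmul', assocSymmAux_tmul, assocSymmAux_tmul, smul_tmul]
      | ha s t hs ht => rw [smul_add, map_add, map_add, hs, ht])

theorem assocSymm_tmul (x : N) (b : B) (y : M) :
    assocSymm (tmul R x (tmul R b y)) = tmul R (tmul R x b) y := by
  rfl

theorem assoc_assocSymm (t : BTensor R N (BTensor R B M)) : assoc (assocSymm t) = t := by
  induction t using BTensor.induction with
  | h0 => simp
  | ht x w =>
    induction w using BTensor.induction with
    | h0 => simp [tmul_zero]
    | ht b y => rw [assocSymm_tmul, assoc_tmul]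
    | ha s t hs ht => simp only [tmul_add, map_add, hs, ht]
  | ha s t hs ht => simp only [map_add, hs, ht]

end BTensor

/-! ### The left dual as the endomorphisms of the left comodule `C` -/

namespace LeftDual

variable {R C : Type u} [Ring R] [AddCommGroup C] [Module R C] [Module Rᵐᵒᵖ C]
  [SMulCommClass R Rᵐᵒᵖ C] [Coring R C]

/-- The contraction `C ⊗_R C → C`, `c ⊗ d ↦ c f(d)`, as a map of left modules. -/
noncomputable def contractRightHom (f : LeftDual R C) : BTensor R C C →ₗ[R] C :=
  ⟨⟨BTensor.contractRight f.toLin, map_add _⟩, contractRight_smul f.toLin⟩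

omit [Coring R C] in
theorem contractRight_assoc {M : Type*} [AddCommGroup M] [Module Rᵐᵒᵖ M] (f : LeftDual R C)
    (t : BTensor R (BTensor R M C) C) :
    BTensor.map LinearMap.id f.contractRightHom (BTensor.assoc t)
      = BTensor.contractRight f.toLin t := by
  induction t using BTensor.induction with
  | h0 => simp
  | ht w y =>
    induction w using BTensor.induction with
    | h0 => simp [BTensor.zero_tmul]
    | ht a b => simp [contractRightHom]
    | ha s t hs ht => simp only [BTensor.add_tmul, map_add, hs, ht]
  | ha s t hs ht => simp only [map_add, hs, ht]

omit [Module Rᵐᵒᵖ C] [SMulCommClass R Rᵐᵒᵖ C] [Coring R C] in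
theorem tensor_ext (hleft : LeftAlpha R C) {M : Type u} [AddCommGroup M] [Module Rᵐᵒᵖ M]
    {s t : BTensor R M C} (h : ∀ f : LeftDual R C, BTensor.contractRight f.toLin s
      = BTensor.contractRight f.toLin t) : s = t :=
  BTensor.ext_of_leftAlpha hleft h

omit [Module Rᵐᵒᵖ C] [SMulCommClass R Rᵐᵒᵖ C] [Coring R C] in
theorem separates (hleft : LeftAlpha R C) {c d : C}
    (h : ∀ f : LeftDual R C, f.toLin c = f.toLin d) : c = d :=
  hleft.eq_of_forall h

-- After rebracketing, this is the `α`-condition for the right module `M ⊗ C`. It serves to verify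
-- coassociativity of a coaction one form at a time.
omit [Coring R C] in
theorem tensor_tensor_ext (hleft : LeftAlpha R C) {M : Type u} [AddCommGroup M]
    [Module Rᵐᵒᵖ M] {s t : BTensor R M (BTensor R C C)}
    (h : ∀ f : LeftDual R C, BTensor.map LinearMap.id f.contractRightHom s
      = BTensor.map LinearMap.id f.contractRightHom t) : s = t := by
  rw [← BTensor.assoc_assocSymm s, ← BTensor.assoc_assocSymm t]
  congr 1
  refine tensor_ext hleft fun f => ?_
  have hf := h f
  rw [← BTensor.assoc_assocSymm s, ← BTensor.assoc_assocSymm t, contractRight_assoc,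
    contractRight_assoc] at hf
  exact hf

theorem contractRight_add {M : Type*} [AddCommGroup M] [Module Rᵐᵒᵖ M] (f g : LeftDual R C)
    (t : BTensor R M C) :
    BTensor.contractRight (f + g).toLin t
      = BTensor.contractRight f.toLin t + BTensor.contractRight g.toLin t := by
  induction t using BTensor.induction with
  | h0 => simp
  | ht x y => simp [toLin_add, add_smul]
  | ha s t hs ht => simp only [map_add, hs, ht]; abel

theorem contractRight_zero {M : Type*} [AddCommGroup M] [Module Rᵐᵒᵖ M] (t : BTensor R M C) :
    BTensor.contractRight (0 : LeftDual R C).toLin t = 0 := by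
  have h := contractRight_add (0 : LeftDual R C) 0 t
  rw [add_zero] at h
  simpa using h

theorem actLeft_apply (f : LeftDual R C) (c : C) :
    f.actLeft c = BTensor.contractRight f.toLin (Coring.comul (R := R) c) := by
  rfl

theorem add_actLeft (f g : LeftDual R C) (c : C) :
    (f + g).actLeft c = f.actLeft c + g.actLeft c :=
  contractRight_add f g _

theorem zero_actLeft (c : C) : (0 : LeftDual R C).actLeft c = 0 :=
  contractRight_zero _

theorem one_actLeft (c : C) : (1 : LeftDual R C).actLeft c = c :=
  Coring.comul_counit c

theorem sum_actLeft {ι : Type*} (s : Finset ι) (f : ι → LeftDual R C) (c : C) :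
    (∑ i ∈ s, f i).actLeft c = ∑ i ∈ s, (f i).actLeft c :=
  map_sum (AddMonoidHom.mk' (fun f : LeftDual R C => f.actLeft c)
    fun f g => add_actLeft f g c) f s

theorem sub_actLeft (f g : LeftDual R C) (c : C) :
    (f - g).actLeft c = f.actLeft c - g.actLeft c :=
  map_sub (AddMonoidHom.mk' (fun f : LeftDual R C => f.actLeft c)
    fun f g => add_actLeft f g c) f g

theorem counit_actLeft (f : LeftDual R C) (c : C) :
    Coring.counit (R := R) (f.actLeft c) = f.toLin c :=
  congrArg (fun h : LeftDual R C => h.toLin c) (mul_one f)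

theorem toLin_mul (f g : LeftDual R C) (c : C) : (f * g).toLin c = g.toLin (f.actLeft c) := by
  rfl

/-- The counit recovers `f` from its action, so `{}^*C` acts faithfully on `C`. -/
theorem ext_actLeft {f g : LeftDual R C} (h : ∀ c, f.actLeft c = g.actLeft c) : f = g :=
  LeftDual.ext fun c => by rw [← counit_actLeft, h, counit_actLeft]

/-- Contractions on the two outer factors of `c₍₁₎ ⊗ c₍₂₎ ⊗ c₍₃₎` commute, and coassociativity
allows either one to be done first. -/
theorem isColinear_actLeft (hright : RightAlpha R C) (f : LeftDual R C) :
    IsColinear R C f.actLeft := by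
  refine isColinear_of_map_dualAct hright fun g c => ?_
  have h : ∀ t : BTensor R (BTensor R C C) C,
      BTensor.contractLeft g (BTensor.contractRight f.toLin t)
        = BTensor.contractRight f.toLin (BTensor.contractLeft g (BTensor.assoc t)) := by
    intro t
    induction t using BTensor.induction with
    | h0 => simp
    | ht w y =>
      induction w using BTensor.induction with
      | h0 => simp [BTensor.zero_tmul]
      | ht a b => simp [smul_comm]
      | ha s t hs ht => simp only [BTensor.add_tmul, map_add, hs, ht]
    | ha s t hs ht => simp only [map_add, hs, ht]
  have h1 := h (BTensor.map (Coring.comulR R C) LinearMap.id (Coring.comul (R := R) c))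
  rw [BTensor.contractRight_map] at h1
  have h2 : BTensor.assoc (BTensor.map (Coring.comulR R C) LinearMap.id (Coring.comul (R := R) c))
      = BTensor.map LinearMap.id (Coring.comul (R := R)) (Coring.comul (R := R) c) :=
    Coring.coassoc c
  rw [h2, BTensor.contractLeft_map] at h1
  exact h1.symm

/-- Every endomorphism of the left comodule `C` is given by an element of the left dual. -/
theorem exists_actLeft_eq {φ : C →ₗ[R] C} (hφ : IsColinear R C φ) :
    ∃ f : LeftDual R C, ∀ c, f.actLeft c = φ c := by
  -- Colinearity gives `c₍₁₎ ε(φ(c₍₂₎)) = φ(c)₍₁₎ ε(φ(c)₍₂₎) = φ(c)`.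
  let f : LeftDual R C := (Coring.counit (R := R)).comp φ
  refine ⟨f, fun c => ?_⟩
  have h : ∀ t : BTensor R C C, BTensor.contractRight f.toLin t
      = BTensor.contractRight (Coring.counit (R := R)) (BTensor.map LinearMap.id φ t) := by
    intro t
    induction t using BTensor.induction with
    | h0 => simp
    | ht x y => rfl
    | ha s t hs ht => simp only [map_add, hs, ht]
  have h1 : BTensor.map LinearMap.id φ (Coring.comul (R := R) c) = Coring.comul (R := R) (φ c) :=
    (hφ c).symm
  rw [actLeft_apply, h, h1, Coring.comul_counit]

/-- The element `c ↦ ε(c) r` of the left dual. -/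
noncomputable def counitMul (r : R) : LeftDual R C :=
  (LinearMap.toSpanSingleton R R r).comp (Coring.counit (R := R))

theorem counitMul_apply (r : R) (c : C) :
    (counitMul r : LeftDual R C).toLin c = Coring.counit (R := R) c * r := by
  rfl

theorem counitMul_actLeft (r : R) (c : C) : (counitMul r : LeftDual R C).actLeft c = op r • c := by
  have h : ∀ t : BTensor R C C, BTensor.contractRight (counitMul r : LeftDual R C).toLin t
      = op r • BTensor.contractRight (Coring.counit (R := R)) t := by
    intro t
    induction t using BTensor.induction with
    | h0 => simp
    | ht x y => simp [counitMul_apply, mul_smul]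
    | ha s t hs ht => simp only [map_add, smul_add, hs, ht]
  rw [actLeft_apply, h, Coring.comul_counit]

variable (R C) in
/-- The ring homomorphism from `R` to the left dual. -/
noncomputable def counitMulHom : R →+* LeftDual R C where
  toFun := counitMul
  map_one' := ext_actLeft fun c => by rw [counitMul_actLeft, one_actLeft, op_one, one_smul]
  map_mul' r s := ext_actLeft fun c => by
    rw [actLeft_mul, counitMul_actLeft, counitMul_actLeft, counitMul_actLeft, op_mul, mul_smul]
  map_zero' := ext_actLeft fun c => by rw [counitMul_actLeft, zero_actLeft, op_zero, zero_smul]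
  map_add' r s := ext_actLeft fun c => by
    rw [add_actLeft, counitMul_actLeft, counitMul_actLeft, counitMul_actLeft, op_add, add_smul]

/-- For `x` in a finite set, `x₍₁₎ ⊗ x₍₂₎ = ∑ (x · gₗ) ⊗ cₗ` with `gₗ` and `cₗ` independent
of `x`. -/
theorem exists_finite_expansion (hleft : LeftAlpha R C) (F : Finset C) :
    ∃ (n : ℕ) (g : Fin n → LeftDual R C) (c : Fin n → C), ∀ x ∈ F, ∀ f : LeftDual R C,
      f.actLeft x = (∑ l, g l * counitMul (f.toLin (c l))).actLeft x := by
  classical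
  -- All `x ∈ F` are treated at once: `N'` is the orbit under `{}^*C` of the tuple `(x)` in `C^F`,
  -- and `t` below is the tuple of the `Δ(x)`. Contracting `t` with `f` gives the tuple acted on by
  -- `f`, so `t` comes from `N' ⊗ C`; the `g l` represent the left factors of a preimage.
  let N' : Submodule Rᵐᵒᵖ (F → C) :=
    { carrier := Set.range fun (f : LeftDual R C) (x : F) => f.actLeft (x : C)
      add_mem' := by
        rintro _ _ ⟨f, rfl⟩ ⟨g, rfl⟩
        exact ⟨f + g, funext fun x => add_actLeft f g _⟩
      zero_mem' := ⟨0, funext fun x => zero_actLeft _⟩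
      smul_mem' := by
        rintro r _ ⟨f, rfl⟩
        exact ⟨f * counitMul r.unop, funext fun x => by
          exact (actLeft_mul f _ _).trans (counitMul_actLeft _ _)⟩ }
  let t : BTensor R (F → C) C := ∑ x : F,
    BTensor.map (LinearMap.single Rᵐᵒᵖ (fun _ : F => C) x) LinearMap.id
      (Coring.comul (R := R) (x : C))
  have ht (f : LeftDual R C) :
      BTensor.contractRight f.toLin t = fun x : F => f.actLeft (x : C) := by
    simp only [t, map_sum, BTensor.contractRight_map]
    exact Finset.univ_sum_single (fun x : F => f.actLeft (x : C))
  obtain ⟨t', ht'⟩ := BTensor.exists_of_contractRight_mem hleft N' t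
    fun f => ⟨f, (ht f).symm⟩
  obtain ⟨n, v, c, rfl⟩ := BTensor.exists_sum t'
  choose g hg using fun l => (v l).2
  refine ⟨n, g, c, fun x hx f => ?_⟩
  have h := congrFun (ht f) ⟨x, hx⟩
  rw [← ht', BTensor.contractRight_map] at h
  rw [← h, sum_actLeft]
  simp only [map_sum, BTensor.contractRight_tmul, map_smul, Submodule.subtype_apply, ← hg,
    Finset.sum_apply, Pi.smul_apply, actLeft_mul, counitMul_actLeft]

end LeftDual

/-! ### Rational elements and exactness of `Rat` -/

section Rational

variable {R C : Type u} [Ring R] [AddCommGroup C] [Module R C] [Module Rᵐᵒᵖ C]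
  [SMulCommClass R Rᵐᵒᵖ C] [Coring R C]
  {M M' : Type u} [AddCommGroup M] [Module (LeftDual R C)ᵐᵒᵖ M]
  [AddCommGroup M'] [Module (LeftDual R C)ᵐᵒᵖ M']

variable (R C) in
/-- The element `m` is annihilated by the annihilator of a finite subset of `C`. Under the left
`α`-condition these are the elements of the rational part. -/
def IsRationalElement (m : M) : Prop :=
  ∃ F : Finset C, ∀ f : LeftDual R C, (∀ x ∈ F, f.actLeft x = 0) → op f • m = 0

variable (R C M) in
/-- The submodule of rational elements. -/
def rationalElements : Submodule (LeftDual R C)ᵐᵒᵖ M where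
  carrier := {m | IsRationalElement R C m}
  add_mem' := by
    classical
    rintro m n ⟨F, hF⟩ ⟨G, hG⟩
    refine ⟨F ∪ G, fun f hf => ?_⟩
    rw [smul_add, hF f fun x hx => hf x (Finset.mem_union_left _ hx),
      hG f fun x hx => hf x (Finset.mem_union_right _ hx), add_zero]
  zero_mem' := ⟨∅, fun f _ => smul_zero _⟩
  smul_mem' := by
    classical
    rintro a m ⟨F, hF⟩
    refine ⟨F.image a.unop.actLeft, fun f hf => ?_⟩
    have h := hF (a.unop * f) fun x hx => by
      rw [LeftDual.actLeft_mul]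
      exact hf _ (Finset.mem_image_of_mem _ hx)
    rwa [op_mul, mul_smul, op_unop] at h

/-- With the `g l` and `c l` of the finite expansion for `F`, the form `f - ∑ g l * (ε(-) f(c l))`
kills `F`, hence `m`. So `∑ (m · g l) ⊗ c l` is the value of the coaction at `m`. -/
theorem IsRationalElement.exists_tensor [Module Rᵐᵒᵖ M] (hleft : LeftAlpha R C)
    (hcomp : ∀ (r : R) (m : M), op r • m = op (LeftDual.counitMul r : LeftDual R C) • m) {m : M}
    (hm : IsRationalElement R C m) :
    ∃ t : BTensor R M C, ∀ f : LeftDual R C, BTensor.contractRight f.toLin t = op f • m := by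
  obtain ⟨F, hF⟩ := hm
  obtain ⟨n, g, c, h⟩ := LeftDual.exists_finite_expansion hleft F
  refine ⟨∑ l, BTensor.tmul R (op (g l) • m) (c l), fun f => ?_⟩
  have h0 := hF (f - ∑ l, g l * LeftDual.counitMul (f.toLin (c l))) fun x hx => by
    rw [LeftDual.sub_actLeft, ← h x hx, sub_self]
  rw [op_sub, sub_smul, sub_eq_zero] at h0
  rw [h0, Finset.op_sum, Finset.sum_smul, map_sum]
  refine Finset.sum_congr rfl fun l _ => ?_
  rw [BTensor.contractRight_tmul, hcomp, op_mul, mul_smul]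

omit [Module (LeftDual R C)ᵐᵒᵖ M] in
theorem LeftDual.contractRight_op_smul [Module Rᵐᵒᵖ M] (f : LeftDual R C) (r : Rᵐᵒᵖ)
    (t : BTensor R M C) :
    BTensor.contractRight f.toLin (r • t)
      = BTensor.contractRight ((LeftDual.counitMul r.unop : LeftDual R C) * f).toLin t := by
  induction t using BTensor.induction with
  | h0 => simp
  | ht x y => simp [LeftDual.toLin_mul, LeftDual.counitMul_actLeft]
  | ha s t hs ht => simp only [smul_add, map_add, hs, ht]

omit [Module (LeftDual R C)ᵐᵒᵖ M] in
theorem LeftDual.contractRight_actLeft [Module Rᵐᵒᵖ M] (f g : LeftDual R C)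
    (t : BTensor R M C) :
    BTensor.contractRight g.toLin (BTensor.map LinearMap.id f.actLeft t)
      = BTensor.contractRight (f * g).toLin t := by
  induction t using BTensor.induction with
  | h0 => simp
  | ht x y => simp [LeftDual.toLin_mul]
  | ha s t hs ht => simp only [map_add, hs, ht]

/-- A right module over the left dual all of whose elements are rational is a right comodule. -/
theorem exists_rightComodule (hleft : LeftAlpha R C) (h : ∀ m : M, IsRationalElement R C m) :
    ∃ (_ : Module Rᵐᵒᵖ M) (_ : RightComodule R C M), ∀ (m : M) (f : LeftDual R C),
      op f • m = BTensor.contractRight f.toLin (RightComodule.coact (R := R) (C := C) m) := by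
  let _ : Module Rᵐᵒᵖ M := Module.compHom M (LeftDual.counitMulHom R C).op
  have hcomp (r : R) (m : M) : op r • m = op (LeftDual.counitMul r : LeftDual R C) • m := by
    rfl
  choose δ hδ using fun m => (h m).exists_tensor hleft hcomp
  let Δ : M →ₗ[Rᵐᵒᵖ] BTensor R M C :=
    { toFun := δ
      map_add' := fun m n => LeftDual.tensor_ext hleft fun f => by
        rw [map_add]
        exact (hδ (m + n) f).trans ((smul_add _ m n).trans
          (congrArg₂ (· + ·) (hδ m f).symm (hδ n f).symm))
      map_smul' := fun r m => LeftDual.tensor_ext hleft fun f => by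
        refine (hδ _ f).trans (Eq.trans ?_
          (LeftDual.contractRight_op_smul (C := C) f r (δ m)).symm)
        rw [hδ, op_mul, mul_smul]
        rfl }
  have hΔ (m : M) (f : LeftDual R C) : BTensor.contractRight f.toLin (Δ m) = op f • m := hδ m f
  refine ⟨inferInstance, ⟨Δ, fun m => ?_, fun m => ?_⟩, fun m f => (hΔ m f).symm⟩
  -- Contracting the last factor with `f` reduces coassociativity to the identity that `Δ (m · f)`
  -- is the image of `Δ m` under `id ⊗ f.actLeft`.
  · refine LeftDual.tensor_tensor_ext hleft fun f => ?_
    have h1 : f.contractRightHom.comp (Coring.comul (R := R)) = f.actLeft := by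
      rfl
    rw [LeftDual.contractRight_assoc, BTensor.contractRight_map, BTensor.map_map, h1, hΔ]
    refine LeftDual.tensor_ext hleft fun g => ?_
    refine (hΔ _ g).trans (Eq.trans ?_ (LeftDual.contractRight_actLeft f g (Δ m)).symm)
    rw [hΔ, op_mul, mul_smul]
  · exact (hΔ m 1).trans (one_smul _ m)

/-- If the coaction of `m` is `∑ xᵢ ⊗ cᵢ`, then `m` is killed by every `f` that kills all `cᵢ`.
Conversely, the rational elements form a submodule that carries a coaction by
`exists_rightComodule`. -/
theorem ratSubmodule_eq (hleft : LeftAlpha R C) : ratSubmodule R C M = rationalElements R C M := by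
  classical
  refine le_antisymm (sSup_le ?_) (le_sSup ?_)
  · rintro N ⟨_, _, hN⟩ m hm
    obtain ⟨n, x, c, hxc⟩ := BTensor.exists_sum
      (RightComodule.coact (R := R) (C := C) (⟨m, hm⟩ : N))
    refine ⟨Finset.univ.image c, fun f hf => ?_⟩
    have h := hN ⟨m, hm⟩ f
    rw [hxc, map_sum, Finset.sum_eq_zero] at h
    · exact congrArg Subtype.val h
    · intro i _
      rw [BTensor.contractRight_tmul, ← LeftDual.counit_actLeft,
        hf _ (Finset.mem_image_of_mem _ (Finset.mem_univ i)), map_zero, op_zero, zero_smul]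
  · refine exists_rightComodule hleft fun m => ?_
    obtain ⟨F, hF⟩ := m.2
    exact ⟨F, fun f hf => Subtype.ext (hF f hf)⟩

theorem mem_ratSubmodule (hleft : LeftAlpha R C) {m : M} :
    m ∈ ratSubmodule R C M ↔ IsRationalElement R C m := by
  rw [ratSubmodule_eq hleft]; rfl

theorem IsRationalElement.map {m : M} (hm : IsRationalElement R C m)
    (g : M →ₗ[(LeftDual R C)ᵐᵒᵖ] M') : IsRationalElement R C (g m) := by
  obtain ⟨F, hF⟩ := hm
  exact ⟨F, fun f hf => by rw [← map_smul, hF f hf, map_zero]⟩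

theorem IsRationalElement.of_map {m : M} {g : M →ₗ[(LeftDual R C)ᵐᵒᵖ] M'}
    (hg : Function.Injective g) (hm : IsRationalElement R C (g m)) : IsRationalElement R C m := by
  obtain ⟨F, hF⟩ := hm
  exact ⟨F, fun f hf => hg (by rw [map_smul, hF f hf, map_zero])⟩

theorem IsRationalElement.op_smul {t : LeftDual R C} (ht : IsRationalElement R C t) (m : M) :
    IsRationalElement R C (op t • m) := by
  obtain ⟨F, hF⟩ := ht
  refine ⟨F, fun f hf => ?_⟩
  have h : t * f = 0 := hF f hf
  rw [← mul_smul, ← op_mul, h, op_zero, zero_smul]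

/-- If the rational elements of the left dual fix every finite subset of `C`, then the rational
part is an exact functor. -/
theorem ratIsExact_of_exists (hleft : LeftAlpha R C)
    (h : ∀ F : Finset C, ∃ t : LeftDual R C, IsRationalElement R C t ∧ ∀ x ∈ F, t.actLeft x = x) :
    RatIsExact R C := by
  intro X Y Z _ _ _ _ _ _ f g hf hfg hg
  constructor
  · ext y
    rw [Submodule.mem_inf, mem_ratSubmodule hleft, LinearMap.mem_ker, Submodule.mem_map]
    constructor
    · rintro ⟨x, hx, rfl⟩
      exact ⟨((mem_ratSubmodule hleft).1 hx).map f, (hfg _).2 ⟨x, rfl⟩⟩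
    · rintro ⟨hy, hgy⟩
      obtain ⟨x, rfl⟩ := (hfg y).1 hgy
      exact ⟨x, (mem_ratSubmodule hleft).2 (hy.of_map hf), rfl⟩
  · ext z
    rw [mem_ratSubmodule hleft, Submodule.mem_map]
    constructor
    · rintro ⟨y, hy, rfl⟩
      exact ((mem_ratSubmodule hleft).1 hy).map g
    · rintro ⟨F, hF⟩
      obtain ⟨t, ht, htF⟩ := h F
      obtain ⟨y, rfl⟩ := hg z
      refine ⟨op t • y, (mem_ratSubmodule hleft).2 (ht.op_smul y), ?_⟩
      -- `1 - t` kills `F`, hence also the image of `y`.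
      have h0 := hF (1 - t) fun x hx => by
        rw [LeftDual.sub_actLeft, LeftDual.one_actLeft, htF x hx, sub_self]
      rw [op_sub, sub_smul, op_one, one_smul, sub_eq_zero] at h0
      rw [map_smul, ← h0]

variable (R C) in
/-- The right module structure of a coring over its left dual. -/
noncomputable abbrev LeftDual.coringModule : Module (LeftDual R C)ᵐᵒᵖ C where
  smul f c := f.unop.actLeft c
  one_smul c := LeftDual.one_actLeft c
  mul_smul f g c := LeftDual.actLeft_mul g.unop f.unop c
  smul_zero _ := map_zero _
  smul_add _ := map_add _
  add_smul f g c := LeftDual.add_actLeft f.unop g.unop c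
  zero_smul c := LeftDual.zero_actLeft c

/-- If the rational part is an exact functor, then every element of `C` is fixed by a rational
element of the left dual. -/
theorem RatIsExact.exists_actLeft_eq (hleft : LeftAlpha R C) (h : RatIsExact R C) (x : C) :
    ∃ t : LeftDual R C, IsRationalElement R C t ∧ t.actLeft x = x := by
  let _ := LeftDual.coringModule R C
  let φ : LeftDual R C →ₗ[(LeftDual R C)ᵐᵒᵖ] C :=
    { toFun := fun f => f.actLeft x
      map_add' := fun f g => LeftDual.add_actLeft f g x
      map_smul' := fun a f => LeftDual.actLeft_mul f a.unop x }
  have hex := (h _ _ _ (LinearMap.ker φ).subtype φ.rangeRestrict (Submodule.injective_subtype _)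
    (by
      intro f
      rw [Submodule.coe_subtype, Subtype.range_coe_subtype]
      exact Subtype.ext_iff)
    φ.surjective_rangeRestrict).2
  -- In the cyclic module `x · {}^*C`, the element `x` is rational with witness `{x}`.
  have hx : (⟨x, 1, LeftDual.one_actLeft x⟩ : LinearMap.range φ) ∈
      ratSubmodule R C (LinearMap.range φ) :=
    (mem_ratSubmodule hleft).2 ⟨{x}, fun f hf => Subtype.ext (hf x (Finset.mem_singleton_self x))⟩
  rw [← hex] at hx
  obtain ⟨t, ht, htx⟩ := hx
  exact ⟨t, (mem_ratSubmodule hleft).1 ht, congrArg Subtype.val htx⟩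

/-- The image of a rational element of the left dual is contained in a finitely generated
module. -/
theorem IsRationalElement.exists_fg_range_le (hleft : LeftAlpha R C) {t : LeftDual R C}
    (ht : IsRationalElement R C t) :
    ∃ L : Submodule R C, L.FG ∧ LinearMap.range t.actLeft ≤ L := by
  obtain ⟨F, hF⟩ := ht
  obtain ⟨n, g, c, h⟩ := LeftDual.exists_finite_expansion hleft F
  refine ⟨Submodule.span R (Set.range c), Submodule.fg_span (Set.finite_range c), ?_⟩
  rintro _ ⟨x, rfl⟩
  -- Rationality of `t` gives `t * f = ∑ t * g l * (ε(-) f(c l))`. Evaluated at `x`, this is what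
  -- `f` sees of the two sides, and left forms separate points.
  have hx : t.actLeft x = ∑ l, (t * g l).toLin x • c l := by
    refine LeftDual.separates hleft fun f => ?_
    have h0 : t * (f - ∑ l, g l * LeftDual.counitMul (f.toLin (c l)) :
        LeftDual R C) = 0 := hF _ fun x hx => by
      rw [LeftDual.sub_actLeft, ← h x hx, sub_self]
    rw [mul_sub, sub_eq_zero, Finset.mul_sum] at h0
    have h1 := congrArg (fun k : LeftDual R C => Coring.counit (R := R) (k.actLeft x)) h0
    simp only [LeftDual.sum_actLeft, map_sum, LeftDual.counit_actLeft, ← mul_assoc] at h1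
    rw [LeftDual.toLin_mul] at h1
    refine h1.trans ?_
    rw [map_sum]
    refine Finset.sum_congr rfl fun l _ => ?_
    rw [LeftDual.toLin_mul, LeftDual.counitMul_apply, LeftDual.counit_actLeft, map_smul,
      smul_eq_mul]
  rw [hx]
  exact Submodule.sum_mem _ fun l _ => Submodule.smul_mem _ _ (Submodule.subset_span ⟨l, rfl⟩)

end Rational

/-! ### Injectivity of `C` and the two implications -/

section InjectiveCoring

variable {R C : Type u} [Ring R] [AddCommGroup C] [Module R C] [Module Rᵐᵒᵖ C]
  [SMulCommClass R Rᵐᵒᵖ C] [Coring R C]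

theorem LeftDual.actLeft_dualAct (hright : RightAlpha R C) (t : LeftDual R C)
    (f : C →ₗ[Rᵐᵒᵖ] R) (c : C) : t.actLeft (dualAct f c) = dualAct f (t.actLeft c) :=
  (LeftDual.isColinear_actLeft hright t).map_dualAct f c

theorem LeftDual.dualStable_ker_actLeft (hright : RightAlpha R C) (t : LeftDual R C) :
    DualStable C (LinearMap.ker t.actLeft) :=
  DualStable.ker_of_isColinear (LeftDual.isColinear_actLeft hright t)

/-- If `C` is injective, then colinear maps from subcomodules of `C` to `C` extend along
injective endomorphisms. -/
theorem IsInjectiveComodule.exists_extension (hright : RightAlpha R C)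
    (hinj : IsInjectiveComodule R C C) {N : Submodule R C} (hN : DualStable C N)
    (t : LeftDual R C) (ht : ∀ x ∈ N, t.actLeft x = 0 → x = 0) (φ : N →ₗ[R] C)
    (hφ : ∀ (f : C →ₗ[Rᵐᵒᵖ] R) (x : N), φ ⟨dualAct f (x : C), hN f x x.2⟩ = dualAct f (φ x)) :
    ∃ a : LeftDual R C, ∀ x : N, a.actLeft (t.actLeft (x : C)) = φ x := by
  obtain ⟨_, hsub⟩ := hN.isSubcomodule hright
  have hact (f : C →ₗ[Rᵐᵒᵖ] R) (x : N) : dualAct f x = ⟨dualAct f (x : C), hN f x x.2⟩ :=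
    Subtype.ext (hsub.map_dualAct f x)
  obtain ⟨g, hg, hgt⟩ := hinj N C (t.actLeft.comp N.subtype) φ
    (isColinear_of_map_dualAct hright fun f x => by
      rw [hact]
      exact t.actLeft_dualAct hright f x)
    ((injective_iff_map_eq_zero _).2 fun x hx => Subtype.ext (ht x x.2 hx))
    (isColinear_of_map_dualAct hright fun f x => by rw [hact, hφ])
  obtain ⟨a, ha⟩ := LeftDual.exists_actLeft_eq hg
  exact ⟨a, fun x => (ha _).trans (LinearMap.congr_fun hgt x)⟩

/-- An injective subcomodule of `C` is a direct summand, also after an injective map to `C`. -/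
theorem IsInjectiveHullIn.exists_retraction (hright : RightAlpha R C) {S E : Submodule R C}
    (hE : IsInjectiveHullIn R C S E) (t : LeftDual R C)
    (ht : ∀ x ∈ E, t.actLeft x = 0 → x = 0) :
    ∃ e : LeftDual R C, (∀ c, e.actLeft c ∈ E) ∧ ∀ x ∈ E, e.actLeft (t.actLeft x) = x := by
  obtain ⟨_, hsub, hinj⟩ := hE.injective
  -- The identity of the injective comodule `E` extends along the embedding of `E` in `C` given by
  -- `t`.
  obtain ⟨g, hg, hgt⟩ := hinj E C (t.actLeft.comp E.subtype) LinearMap.id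
    (isColinear_of_map_dualAct hright fun f x => by
      rw [LinearMap.comp_apply, hsub.map_dualAct]
      exact t.actLeft_dualAct hright f x)
    ((injective_iff_map_eq_zero _).2 fun x hx => Subtype.ext (ht x x.2 hx))
    (isColinear_of_map_dualAct hright fun f x => rfl)
  obtain ⟨e, he⟩ := LeftDual.exists_actLeft_eq (φ := E.subtype.comp g)
    (isColinear_of_map_dualAct hright fun f x => by
      rw [LinearMap.comp_apply, hg.map_dualAct, hsub.map_dualAct]; rfl)
  refine ⟨e, fun c => ?_, fun x hx => ?_⟩
  · rw [he]
    exact (g c).2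
  · rw [he]
    exact congrArg Subtype.val (LinearMap.congr_fun hgt ⟨x, hx⟩)

/-- If `C` is injective, then the projection of a direct sum of two subcomodules extends to an
endomorphism of `C`. -/
theorem IsInjectiveComodule.exists_projection (hright : RightAlpha R C)
    (hinj : IsInjectiveComodule R C C) {N D : Submodule R C} (hN : DualStable C N)
    (hD : DualStable C D) (h : Disjoint N D) :
    ∃ a : LeftDual R C, (∀ x ∈ N, a.actLeft x = x) ∧ ∀ x ∈ D, a.actLeft x = 0 := by
  let p : C →ₗ.[R] C := ⟨N, N.subtype⟩
  let q : C →ₗ.[R] C := ⟨D, 0⟩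
  -- Disjointness makes the inclusion of `N` and the zero map of `D` agree on their common domain,
  -- so they glue to a map on `N ⊔ D`.
  have hpq : ∀ (x : p.domain) (y : q.domain), (x : C) = y → p x = q y := fun x y hxy =>
    Submodule.disjoint_def.1 h (x : C) x.2 (hxy ▸ y.2)
  let φ : ↥(N ⊔ D) →ₗ[R] C := (p.sup q hpq).toFun
  have hφ (x y : C) (z : ↥(N ⊔ D)) (hx : x ∈ N) (hy : y ∈ D) (hz : x + y = (z : C)) : φ z = x := by
    have := LinearPMap.sup_apply hpq (⟨x, hx⟩ : p.domain) (⟨y, hy⟩ : q.domain) z hz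
    exact this.trans (add_zero _)
  obtain ⟨a, ha⟩ := hinj.exists_extension hright (hN.sup hD) 1
    (fun x _ hx => by rwa [LeftDual.one_actLeft] at hx) φ (fun f z => by
      obtain ⟨x, hx, y, hy, hz⟩ := Submodule.mem_sup.1 z.2
      rw [hφ x y z hx hy hz]
      exact hφ _ (dualAct f y) _ (hN f x hx) (hD f y hy) (by rw [← dualAct_add, hz]))
  simp only [LeftDual.one_actLeft] at ha
  refine ⟨a, fun x hx => ?_, fun x hx => ?_⟩
  · rw [ha ⟨x, Submodule.mem_sup_left hx⟩]
    exact hφ x 0 _ hx (zero_mem _) (add_zero x)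
  · rw [ha ⟨x, Submodule.mem_sup_right hx⟩]
    exact hφ 0 x _ (zero_mem _) hx (zero_add x)

theorem exists_isSimpleSubcomodule_le {M : Type u} [AddCommGroup M] [Module R M]
    [LeftComodule R C M] {N K : Submodule R M}
    [WellFoundedLT {K : Submodule R M // IsSubcomodule R C K ∧ K ≤ N}]
    (hK : IsSubcomodule R C K) (hKN : K ≤ N) (hne : K ≠ ⊥) :
    ∃ S ≤ K, IsSimpleSubcomodule R C S := by
  obtain ⟨⟨S, hS, hSN⟩, ⟨hSK, hS0⟩, hmin⟩ := WellFounded.has_min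
    (wellFounded_lt (α := {K : Submodule R M // IsSubcomodule R C K ∧ K ≤ N}))
    {L | L.1 ≤ K ∧ L.1 ≠ ⊥} ⟨⟨K, hK, hKN⟩, le_rfl, hne⟩
  refine ⟨S, hSK, hS, hS0, fun L hL hLS => or_iff_not_imp_left.2 fun hL0 => ?_⟩
  by_contra hne'
  exact hmin ⟨L, hL, hLS.trans hSN⟩ ⟨hLS.trans hSK, hL0⟩ (lt_of_le_of_ne hLS fun h => hne' (congrArg Subtype.val h))

/-- Whatever `t` annihilates on the right, `a * t` annihilates too. Together with
`rationalElements`, this makes the rational part of `{}^*C` a two-sided ideal. -/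
theorem IsRationalElement.mul_left {t : LeftDual R C} (ht : IsRationalElement R C t)
    (a : LeftDual R C) : IsRationalElement R C (a * t) := by
  obtain ⟨F, hF⟩ := ht
  refine ⟨F, fun f hf => ?_⟩
  have h : t * f = 0 := hF f hf
  rw [op_smul_eq_mul, mul_assoc, h, mul_zero]

/-- A form that kills generators of `L` kills all of `L` by left linearity of `actLeft`, so `t * f =
0`. -/
theorem isRationalElement_of_range_le {t : LeftDual R C} {L : Submodule R C} (hL : L.FG)
    (ht : ∀ c, t.actLeft c ∈ L) : IsRationalElement R C t := by
  obtain ⟨F, rfl⟩ := hL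
  refine ⟨F, fun f hf => LeftDual.ext_actLeft fun c => ?_⟩
  have hle : Submodule.span R (F : Set C) ≤ LinearMap.ker f.actLeft :=
    Submodule.span_le.2 fun x hx => hf x hx
  rw [op_smul_eq_mul, LeftDual.actLeft_mul, LeftDual.zero_actLeft]
  exact hle (ht c)

/-- If the rational part is exact, then injective hulls of simple subcomodules of `C` are finitely
generated. -/
theorem RatIsExact.isFGSubcomodule (hleft : LeftAlpha R C) (hright : RightAlpha R C)
    (h : RatIsExact R C) {S E : Submodule R C} (hS : IsSimpleSubcomodule R C S)
    (hE : IsInjectiveHullIn R C S E) : IsFGSubcomodule R C E := by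
  have hEsub : IsSubcomodule R C E := hE.injective.imp fun _ h => h.1
  obtain ⟨x, hxS, hx0⟩ := S.ne_bot_iff.1 hS.2.1
  obtain ⟨t, ht, htx⟩ := h.exists_actLeft_eq hleft x
  obtain ⟨L, hL, hle⟩ := ht.exists_fg_range_le hleft
  have hker := t.dualStable_ker_actLeft hright
  -- By simplicity the intersection is `⊥` or `S`, and `t` fixes the nonzero `x ∈ S`.
  have hkerS : LinearMap.ker t.actLeft ⊓ S = ⊥ := by
    refine (hS.2.2 _ ((hker.inf hS.1.dualStable).isSubcomodule hright) inf_le_right).resolve_right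
      fun heq => hx0 ?_
    have hx : x ∈ LinearMap.ker t.actLeft := (heq.ge hxS).1
    rw [← htx]
    exact hx
  have hkerE : LinearMap.ker t.actLeft ⊓ E = ⊥ :=
    hE.essential _ ((hker.inf hEsub.dualStable).isSubcomodule hright) inf_le_right
      (eq_bot_iff.2 (hkerS ▸ inf_le_inf_right S inf_le_left))
  obtain ⟨e, heE, het⟩ := hE.exists_retraction hright t fun y hyE hy =>
    (Submodule.mem_bot R).1 (hkerE ▸ (⟨hy, hyE⟩ : y ∈ LinearMap.ker t.actLeft ⊓ E))
  have hEL : E = L.map e.actLeft := by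
    refine le_antisymm (fun y hy => ⟨t.actLeft y, hle ⟨y, rfl⟩, het y hy⟩) ?_
    rintro _ ⟨y, -, rfl⟩
    exact heE y
  exact hEsub.isFG (hEL ▸ hL.map _)

/-- If the injective hulls in `C` of the simple summands of the socle are finitely generated, then
the rational elements of the left dual fix every finite subset of `C`. -/
theorem exists_isRationalElement_fixing (hright : RightAlpha R C)
    (hinj : IsInjectiveComodule R C C) (hart : IsLocallyArtinianComodule R C C)
    {I : Type*} {S E : I → Submodule R C} (hsimple : ∀ i, IsSimpleSubcomodule R C (S i))
    (hindep : iSupIndep S) (hsocle : ⨆ i, S i = comoduleSocle R C C)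
    (hE : ∀ i, IsInjectiveHullIn R C (S i) (E i)) (hfg : ∀ i, IsFGSubcomodule R C (E i))
    (F : Finset C) :
    ∃ t : LeftDual R C, IsRationalElement R C t ∧ ∀ x ∈ F, t.actLeft x = x := by
  classical
  have hS (i : I) : DualStable C (S i) := (hsimple i).1.dualStable
  choose a ha using fun i => hinj.exists_projection hright (hS i)
    (DualStable.iSup fun j => DualStable.iSup fun _ : j ≠ i => hS j) (hindep i)
  have ha1 (i : I) (x : C) (hx : x ∈ S i) : (a i).actLeft x = x := (ha i).1 x hx
  have ha0 (i j : I) (hij : j ≠ i) (x : C) (hx : x ∈ S j) : (a i).actLeft x = 0 :=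
    (ha i).2 x (Submodule.mem_iSup_of_mem j (Submodule.mem_iSup_of_mem hij hx))
  have hsoc (x : C) (hx : x ∈ ⨆ i, S i) :
      (∀ i, (a i).actLeft x ∈ S i) ∧ ((∀ i, (a i).actLeft x = 0) → x = 0) := by
    obtain ⟨s, hs, rfl⟩ := (Submodule.mem_iSup_iff_exists_finsupp _ _).1 hx
    have h (i : I) : (a i).actLeft (s.sum fun _ y => y) = s i := by
      rw [Finsupp.sum, map_sum, Finset.sum_eq_single i
        (fun j _ hj => ha0 i j hj _ (hs j)) (fun hi => by
          rw [Finsupp.notMem_support_iff.1 hi, map_zero]), ha1 i _ (hs i)]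
    refine ⟨fun i => h i ▸ hs i, fun h0 => Finset.sum_eq_zero fun i _ => ?_⟩
    rw [← h i, h0]
  choose e heE he using fun i => (hE i).exists_retraction hright 1
    (fun x _ hx => by rwa [LeftDual.one_actLeft] at hx)
  simp only [LeftDual.one_actLeft] at he
  have herat (i : I) : IsRationalElement R C (e i) := by
    obtain ⟨L, hL, hle⟩ := (hfg i).exists_fg_le hright
    exact isRationalElement_of_range_le hL fun c => hle (heE i c)
  let N : Submodule R C := generatedSubcomodule R C F
  have hN : DualStable C N := dualStable_generatedSubcomodule F
  have := hart N (isFGSubcomodule_generatedSubcomodule hright F)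
  -- `K J` is the part of `N ∩ socle` with no component in `S j` for `j ∈ J`. A minimal `K J` exists
  -- by the chain condition; enlarging `J` by any `i` cannot shrink it, so all its components vanish
  -- and it is zero.
  let K (J : Finset I) : Submodule R C :=
    (N ⊓ ⨆ i, S i) ⊓ ⨅ j ∈ J, LinearMap.ker (a j).actLeft
  have hKmem (J : Finset I) (x : C) :
      x ∈ K J ↔ (x ∈ N ∧ x ∈ ⨆ i, S i) ∧ ∀ j ∈ J, (a j).actLeft x = 0 := by
    simp [K, Submodule.mem_iInf]
  have hK (J : Finset I) : DualStable C (K J) := by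
    intro f x hx
    rw [hKmem] at hx ⊢
    refine ⟨⟨hN f x hx.1.1, DualStable.iSup hS f x hx.1.2⟩, fun j hj => ?_⟩
    rw [LeftDual.actLeft_dualAct hright, hx.2 j hj, dualAct_zero]
  obtain ⟨-, ⟨J, rfl⟩, hmin⟩ := WellFounded.has_min
    (wellFounded_lt (α := {K : Submodule R C // IsSubcomodule R C K ∧ K ≤ N}))
    (Set.range fun J => ⟨K J, (hK J).isSubcomodule hright, inf_le_left.trans inf_le_left⟩)
    (Set.range_nonempty _)
  have hJ (x : C) (hx : x ∈ K J) : x = 0 := by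
    refine (hsoc x ((hKmem J x).1 hx).1.2).2 fun i => ?_
    by_contra hi
    refine hmin _ ⟨insert i J, rfl⟩ (lt_of_le_of_ne ?_ fun heq => hi ?_)
    · intro y hy
      rw [hKmem] at hy ⊢
      exact ⟨hy.1, fun j hj => hy.2 j (Finset.mem_insert_of_mem hj)⟩
    · have hKK : K (insert i J) = K J := congrArg Subtype.val heq
      have hx' : x ∈ K (insert i J) := hKK.ge hx
      exact ((hKmem _ x).1 hx').2 i (Finset.mem_insert_self i J)
  -- The factor `a j` is needed because `e j` alone may be nonzero on other summands of the socle.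
  -- Since `e j` fixes `S j`, on the socle `p` is the sum of the projections `a j`.
  let p : LeftDual R C := ∑ j ∈ J, a j * e j
  have hp (x : C) (hx : x ∈ ⨆ i, S i) : p.actLeft x = ∑ j ∈ J, (a j).actLeft x := by
    rw [LeftDual.sum_actLeft]
    refine Finset.sum_congr rfl fun j _ => ?_
    rw [LeftDual.actLeft_mul, he j _ ((hE j).le ((hsoc x hx).1 j))]
  have hpsoc (x : C) (hxN : x ∈ N) (hx : x ∈ ⨆ i, S i) (hpx : p.actLeft x = 0) : x = 0 := by
    refine hJ x ((hKmem J x).2 ⟨⟨hxN, hx⟩, fun k hk => ?_⟩)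
    have h := congrArg (a k).actLeft (hp x hx)
    rwa [hpx, map_zero, map_sum, Finset.sum_eq_single_of_mem k hk
      (fun j _ hj => ha0 k j hj _ ((hsoc x hx).1 j)), ha1 k _ ((hsoc x hx).1 k), eq_comm] at h
  have hpN : LinearMap.ker p.actLeft ⊓ N = ⊥ := by
    by_contra hne
    -- A simple subcomodule of the kernel lies in the socle, where `p` is already injective on `N`.
    obtain ⟨T, hT, hTs⟩ := exists_isSimpleSubcomodule_le
      (((p.dualStable_ker_actLeft hright).inf hN).isSubcomodule hright) inf_le_right hne
    refine hTs.2.1 (eq_bot_iff.2 fun x hx => (Submodule.mem_bot R).2 ?_)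
    exact hpsoc x (hT hx).2 (hsocle ▸ le_sSup hTs (a := T) hx) (hT hx).1
  obtain ⟨b, hb⟩ := hinj.exists_extension hright hN p
    (fun x hxN hx => (Submodule.mem_bot R).1
      (hpN ▸ (⟨hx, hxN⟩ : x ∈ LinearMap.ker p.actLeft ⊓ N))) N.subtype (fun _ _ => rfl)
  refine ⟨p * b, ?_, fun x hx => ?_⟩
  -- `p` is rational because left multiples of the rational `e j` are; its right multiple `p * b`
  -- stays in the right submodule of rational elements.
  · exact (rationalElements R C (LeftDual R C)).smul_mem (op b)
      (Submodule.sum_mem _ fun j _ => (herat j).mul_left (a j))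
  · rw [LeftDual.actLeft_mul]
    exact hb ⟨x, subset_generatedSubcomodule F hx⟩

end InjectiveCoring

theorem proposition2p7 {R C : Type u} [Ring R] [AddCommGroup C] [Module R C] [Module Rᵐᵒᵖ C]
    [SMulCommClass R Rᵐᵒᵖ C] [Coring R C]
    (hleft : LeftAlpha R C) (hright : RightAlpha R C)
    (hinj : IsInjectiveComodule R C C)
    (hart : IsArtinianRing R ∨ IsLocallyArtinianModule R C ∨ IsLocallyArtinianComodule R C C)
    {I : Type*} (S E : I → Submodule R C)
    (hsimple : ∀ i, IsSimpleSubcomodule R C (S i))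
    (hindep : iSupIndep S) (hsocle : ⨆ i, S i = comoduleSocle R C C)
    (hE : ∀ i, IsInjectiveHullIn R C (S i) (E i)) :
    RatIsExact R C ↔ ∀ i, IsFGSubcomodule R C (E i) :=
  ⟨fun h i => h.isFGSubcomodule hleft hright (hsimple i) (hE i), fun h =>
    ratIsExact_of_exists hleft (exists_isRationalElement_fixing hright hinj
      (isLocallyArtinianComodule_of_or hright hart) hsimple hindep hsocle hE h)⟩
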